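/- Let $G$ be a finite simple graph with $|V(G)|\ge 6$ even. Write $\alpha(G)$ and $\omega(G)$ for the maximum sizes of an independent set and of a clique in $G$, and $\bar G$ for the complement of $G$. Suppose that $\alpha(G)\le 2$ and $\omega(G)<|V(G)|/4$, and put $n=|V(G)|/2$ and $k=\omega(G)$. Let $Z$ be a clique of $G$ with $|Z|=k$, and define $$a=\sum_{v\in Z}\deg_{\bar G}(v),\qquad b=|E(\bar G\setminus Z)|,$$ so that $b$ is the number of pairs of distinct non-adjacent vertices of $G$ that lie outside $Z$. Let $\lambda$ be a real number with $0<\lambda\le\frac{k-1}{2}$ and $\lambda^2>2n$, and let $$p=\frac{n-2k}{\,n-\frac{k+1}{2}-\frac{b}{2n-k-2}-\lambda\,}.$$ Then there is a (simple) minor $H$ of $G$ with $|V(H)|=n$ and $$\binom n2-|E(H)|\;\le\;\frac{1}{1-\frac{2n}{\lambda^2}}\left(\frac{b(k-1)^2p^2}{4(2n-k-2)(2n-k-4)}+\frac{a(k-1)p}{2(2n-k-2)}\right).$$ -/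

import Mathlib

/-- `H` is a minor of `G`: there are pairwise disjoint (nonempty) connected vertex sets `B w` of `G`,
one for each vertex `w` of `H`, such that adjacent vertices of `H` have an edge of `G` between
their sets. Equivalently, `H` arises from a subgraph of `G` by contracting edges. -/
def SimpleGraph.IsMinorOf {W V : Type*} (H : SimpleGraph W) (G : SimpleGraph V) : Prop :=
  ∃ B : W → Set V,
    (∀ w, (G.induce (B w)).Connected) ∧
    (∀ u w, u ≠ w → Disjoint (B u) (B w)) ∧
    (∀ u w, H.Adj u w → ∃ x ∈ B u, ∃ y ∈ B w, G.Adj x y)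

/-! Let `K` be the complement of `G`. As α(G) ≤ 2, `K` is triangle-free, so its neighbourhoods are
cliques of `G` and its degrees are at most `k`. The minor has three kinds of branch sets: the `k`
vertices of `Z`, `m = n - 2k` disjoint edges of `G` outside `Z`, and `k` triples (seagulls)
partitioning the remaining `2n - k - 2m = 3k` vertices, each spanning exactly one edge of `K`. Such
a triple is connected in `G`, and every outside vertex has a `G`-neighbour among the ends of its
`K`-edge, since otherwise `K` has a triangle. So edges can be missing only between a matching edge
and a vertex of `Z` non-adjacent to both its ends, or between two matching edges with all four cross
pairs in `K`.

The partition into seagulls (`exists_isPacking_card_eq`, for `k ≥ 4`) comes from local exchanges. If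
a maximum packing `𝒯` is not perfect, a finite case analysis shows that its uncovered set `L` is
independent in `K`, and likewise for every other maximum packing. Then each triple has at most one
vertex with neighbours in `L`, and a suitable choice of another vertex in each triple extends `L` to
an independent set of size `#L + #𝒯 > k`, a contradiction.

For the matching edges, pair up the `N = 2n - k` vertices outside `Z` at random. The number of pairs
lying in `K` has variance at most `N`, so it exceeds its mean by more than λ with probability at
most `2n/λ² < 1`; otherwise at least as many pairs as the denominator of `p` are edges of `G`. Since
the cost is non-negative, restricting to this event costs the factor `1/(1 - 2n/λ²)`
(`exists_perm_weight_le`). Averaging selects `m` of these pairs, scaling linear costs by at most `p`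
and quadratic ones by at most `p²` (`exists_subset_card_eq_weight_le`). The degree bound `k` turns
the expected costs into the terms in `a(k-1)` and `b(k-1)²`. -/

open Finset

/-! ### Packings of one-edge triples and exchanges -/

namespace SimpleGraph

variable {V : Type*} [DecidableEq V]

/-- The vertices `x`, `y`, `z` span exactly one edge of `K`. -/
def OneEdge (K : SimpleGraph V) (x y z : V) : Prop :=
  (K.Adj x y ∧ ¬K.Adj x z ∧ ¬K.Adj y z) ∨ (K.Adj x z ∧ ¬K.Adj x y ∧ ¬K.Adj y z) ∨
    (K.Adj y z ∧ ¬K.Adj x y ∧ ¬K.Adj x z)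

/-- A family of pairwise disjoint triples inside `R`, each spanning exactly one edge of `K`. -/
structure IsPacking (K : SimpleGraph V) (R : Finset V) (𝒯 : Finset (Finset V)) : Prop where
  oneEdge : ∀ T ∈ 𝒯, ∃ x y z, T = {x, y, z} ∧ K.Adj x y ∧ ¬K.Adj x z ∧ ¬K.Adj y z
  subset : ∀ T ∈ 𝒯, T ⊆ R
  disj : ∀ S ∈ 𝒯, ∀ T ∈ 𝒯, S ≠ T → Disjoint S T

variable {K : SimpleGraph V} {R : Finset V} {𝒯 : Finset (Finset V)}

lemma OneEdge.exists_eq {x y z : V} (h : K.OneEdge x y z) :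
    ∃ x' y' z', ({x, y, z} : Finset V) = {x', y', z'} ∧
      K.Adj x' y' ∧ ¬K.Adj x' z' ∧ ¬K.Adj y' z' := by
  rcases h with h | h | h
  · exact ⟨x, y, z, rfl, h⟩
  · exact ⟨x, z, y, by ext; simp; tauto, h.1, h.2.1, fun h' => h.2.2 h'.symm⟩
  · exact ⟨y, z, x, by ext; simp; tauto, h.1, fun h' => h.2.1 h'.symm, fun h' => h.2.2 h'.symm⟩

lemma IsPacking.card_eq_three (h : K.IsPacking R 𝒯) {T : Finset V} (hT : T ∈ 𝒯) : #T = 3 := by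
  obtain ⟨x, y, z, rfl, h1, h2, h3⟩ := h.oneEdge T hT
  rw [Finset.card_eq_three]
  exact ⟨x, y, z, h1.ne, by rintro rfl; exact h3 h1.symm, by rintro rfl; exact h2 h1, rfl⟩

lemma IsPacking.card_biUnion (h : K.IsPacking R 𝒯) : #(𝒯.biUnion id) = 3 * #𝒯 := by
  rw [Finset.card_biUnion (t := id) fun S hS T hT => h.disj S hS T hT,
    sum_congr rfl fun T hT => (h.card_eq_three hT : #(id T) = 3)]
  simp [mul_comm]

lemma IsPacking.biUnion_subset (h : K.IsPacking R 𝒯) : 𝒯.biUnion id ⊆ R :=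
  Finset.biUnion_subset.2 h.subset

/-- The new triples use only vertices freed by `𝒮` or uncovered before, so they avoid the triples
that are kept. -/
lemma IsPacking.exchange (h : K.IsPacking R 𝒯) {𝒮 𝒮' : Finset (Finset V)} (hS : 𝒮 ⊆ 𝒯)
    (h' : K.IsPacking (𝒮.biUnion id ∪ (R \ 𝒯.biUnion id)) 𝒮') :
    K.IsPacking R (𝒯 \ 𝒮 ∪ 𝒮') := by
  have key : ∀ S ∈ 𝒯 \ 𝒮, ∀ T ∈ 𝒮', Disjoint S T := by
    intro S hS1 T hT
    rw [mem_sdiff] at hS1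
    refine Disjoint.mono_right (h'.subset T hT) ?_
    rw [disjoint_union_right, disjoint_biUnion_right]
    refine ⟨fun T' hT' => h.disj _ hS1.1 _ (hS hT') ?_, ?_⟩
    · rintro rfl
      exact hS1.2 hT'
    · rw [Finset.disjoint_left]
      intro x hx hx'
      exact (mem_sdiff.1 hx').2 (mem_biUnion.2 ⟨S, hS1.1, hx⟩)
  refine ⟨fun T hT => ?_, fun T hT => ?_, fun S hS1 T hT hne => ?_⟩
  · rcases mem_union.1 hT with hT | hT
    · exact h.oneEdge T (mem_sdiff.1 hT).1
    · exact h'.oneEdge T hT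
  · rcases mem_union.1 hT with hT | hT
    · exact h.subset T (mem_sdiff.1 hT).1
    · refine (h'.subset T hT).trans (union_subset ?_ sdiff_subset)
      exact (biUnion_subset_biUnion_of_subset_left _ hS).trans h.biUnion_subset
  · rcases mem_union.1 hS1 with hS1 | hS1 <;> rcases mem_union.1 hT with hT | hT
    · exact h.disj _ (mem_sdiff.1 hS1).1 _ (mem_sdiff.1 hT).1 hne
    · exact key _ hS1 _ hT
    · exact (key _ hT _ hS1).symm
    · exact h'.disj _ hS1 _ hT hne

lemma IsPacking.card_exchange (h : K.IsPacking R 𝒯) {𝒮 𝒮' : Finset (Finset V)} (hS : 𝒮 ⊆ 𝒯)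
    (h' : K.IsPacking (𝒮.biUnion id ∪ (R \ 𝒯.biUnion id)) 𝒮') :
    #(𝒯 \ 𝒮 ∪ 𝒮') + #𝒮 = #𝒯 + #𝒮' := by
  have hd : Disjoint (𝒯 \ 𝒮) 𝒮' := by
    rw [Finset.disjoint_left]
    intro S hS1 hS2
    rw [mem_sdiff] at hS1
    have h3 := h.card_eq_three hS1.1
    obtain ⟨x, hx⟩ := card_pos.1 (by omega : 0 < #S)
    rcases mem_union.1 (h'.subset S hS2 hx) with hx' | hx'
    · obtain ⟨T, hT, hxT⟩ := mem_biUnion.1 hx'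
      have : S ≠ T := by rintro rfl; exact hS1.2 hT
      exact Finset.disjoint_left.1 (h.disj _ hS1.1 _ (hS hT) this) hx hxT
    · exact (mem_sdiff.1 hx').2 (mem_biUnion.2 ⟨S, hS1.1, hx⟩)
  rw [card_union_of_disjoint hd]
  have := card_sdiff_add_card_eq_card hS
  omega

lemma exists_isPacking_of_injective {ι : Type*} [Fintype ι] [DecidableEq ι] {A : Finset V}
    (g : ι × Fin 3 → V) (hg : Function.Injective g) (hA : ∀ i, g i ∈ A)
    (h : ∀ i, K.OneEdge (g (i, 0)) (g (i, 1)) (g (i, 2))) :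
    ∃ 𝒮, K.IsPacking A 𝒮 ∧ #𝒮 = Fintype.card ι ∧ 𝒮.biUnion id = univ.image g := by
  let t : ι → Finset V := fun i => {g (i, 0), g (i, 1), g (i, 2)}
  have ht : ∀ i x, x ∈ t i ↔ ∃ j, g (i, j) = x := by
    intro i x
    simp only [t, mem_insert, mem_singleton, Fin.exists_fin_succ]
    simp [eq_comm]
  have hd : ∀ i j, i ≠ j → Disjoint (t i) (t j) := by
    intro i j hij
    rw [Finset.disjoint_left]
    intro x hx hx'
    obtain ⟨a, ha⟩ := (ht _ _).1 hx
    obtain ⟨b, hb⟩ := (ht _ _).1 hx'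
    exact hij (congrArg Prod.fst (hg (ha.trans hb.symm)))
  have hti : Function.Injective t := by
    intro i j hij
    by_contra hne
    have := hd i j hne
    rw [hij, disjoint_self] at this
    have h0 : g (j, 0) ∈ t j := (ht _ _).2 ⟨0, rfl⟩
    rw [this] at h0
    exact absurd h0 (notMem_empty _)
  refine ⟨univ.image t, ⟨?_, ?_, ?_⟩, ?_, ?_⟩
  · intro T hT
    obtain ⟨i, -, rfl⟩ := mem_image.1 hT
    exact (h i).exists_eq
  · intro T hT
    obtain ⟨i, -, rfl⟩ := mem_image.1 hT
    intro x hx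
    obtain ⟨a, rfl⟩ := (ht _ _).1 hx
    exact hA _
  · intro S hS T hT hne
    obtain ⟨i, -, rfl⟩ := mem_image.1 hS
    obtain ⟨j, -, rfl⟩ := mem_image.1 hT
    exact hd i j fun hij => hne (by rw [hij])
  · rw [card_image_of_injective _ hti, card_univ]
  · ext x
    simp only [mem_biUnion, mem_image, mem_univ, true_and, id, Prod.exists]
    constructor
    · rintro ⟨_, ⟨i, rfl⟩, hx⟩
      exact ⟨i, (ht _ _).1 hx⟩
    · rintro ⟨i, hx⟩
      exact ⟨_, ⟨i, rfl⟩, (ht _ _).2 hx⟩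

/-- A packing of maximum size. -/
def IsMaxPacking (K : SimpleGraph V) (R : Finset V) (𝒯 : Finset (Finset V)) : Prop :=
  K.IsPacking R 𝒯 ∧ ∀ 𝒯', K.IsPacking R 𝒯' → #𝒯' ≤ #𝒯

lemma exists_isMaxPacking (K : SimpleGraph V) (R : Finset V) : ∃ 𝒯, K.IsMaxPacking R 𝒯 := by
  classical
  have hfin : ∀ 𝒯, K.IsPacking R 𝒯 → 𝒯 ∈ R.powerset.powerset := fun 𝒯 h =>
    mem_powerset.2 fun T hT => mem_powerset.2 (h.subset T hT)
  have hne : (R.powerset.powerset.filter fun 𝒯 => K.IsPacking R 𝒯).Nonempty :=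
    ⟨∅, mem_filter.2 ⟨by simp, ⟨by simp, by simp, by simp⟩⟩⟩
  obtain ⟨𝒯, h1, h2⟩ := exists_max_image _ card hne
  exact ⟨𝒯, (mem_filter.1 h1).2, fun 𝒯' h' => h2 𝒯' (mem_filter.2 ⟨hfin _ h', h'⟩)⟩

/-- Local optimality, the source of all contradictions below: no exchange can gain a triple. The
next three lemmas specialise it to removing none, one or two triples. -/
lemma IsMaxPacking.false_of_injective (h : K.IsMaxPacking R 𝒯) {𝒮 : Finset (Finset V)}
    (hS : 𝒮 ⊆ 𝒯) {ι : Type*} [Fintype ι] [DecidableEq ι] (hι : #𝒮 < Fintype.card ι)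
    (g : ι × Fin 3 → V) (hg : Function.Injective g)
    (hA : ∀ i, g i ∈ 𝒮.biUnion id ∪ (R \ 𝒯.biUnion id))
    (h' : ∀ i, K.OneEdge (g (i, 0)) (g (i, 1)) (g (i, 2))) : False := by
  obtain ⟨𝒮', h1, h2, -⟩ := exists_isPacking_of_injective g hg hA h'
  have h3 := h.1.card_exchange hS h1
  have h4 := h.2 _ (h.1.exchange hS h1)
  omega

lemma IsMaxPacking.false_of_one (h : K.IsMaxPacking R 𝒯) {x y z : V}
    (hx : x ∈ R \ 𝒯.biUnion id) (hy : y ∈ R \ 𝒯.biUnion id) (hz : z ∈ R \ 𝒯.biUnion id)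
    (hxy : K.Adj x y) (hxz : ¬K.Adj x z) (hyz : ¬K.Adj y z) : False := by
  have h1 : x ≠ z := by rintro rfl; exact hyz hxy.symm
  have h2 : y ≠ z := by rintro rfl; exact hxz hxy
  refine h.false_of_injective (empty_subset 𝒯) (ι := Fin 1) (by simp)
    (fun i => ![x, y, z] i.2) ?_ ?_ ?_
  · rintro ⟨i, j⟩ ⟨i', j'⟩ hij
    have := hxy.ne
    fin_cases i; fin_cases i'; fin_cases j <;> fin_cases j' <;> simp_all
  · rintro ⟨i, j⟩
    rw [mem_union]
    right
    fin_cases j <;> assumption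
  · intro i
    exact Or.inl ⟨hxy, hxz, hyz⟩

/-- Here `f` lists the available vertices once and `p` regroups them, so that the disjointness of
each regrouping is settled by `decide`. -/
lemma IsMaxPacking.false_of_two (h : K.IsMaxPacking R 𝒯) {T : Finset V} (hT : T ∈ 𝒯)
    (f : Fin 6 → V) (hf : Function.Injective f)
    (hA : ∀ i, f i ∈ T ∪ (R \ 𝒯.biUnion id)) (p : Fin 6 → Fin 6) (hp : Function.Injective p)
    (h1 : K.OneEdge (f (p 0)) (f (p 1)) (f (p 2))) (h2 : K.OneEdge (f (p 3)) (f (p 4)) (f (p 5))) :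
    False := by
  let q : Fin 2 × Fin 3 → Fin 6 := fun i => ![![0, 1, 2], ![3, 4, 5]] i.1 i.2
  have hq : Function.Injective q := by decide
  refine h.false_of_injective (singleton_subset_iff.2 hT) (ι := Fin 2) (by simp)
    (f ∘ p ∘ q) (hf.comp (hp.comp hq)) ?_ ?_
  · intro i
    rw [singleton_biUnion]
    exact hA _
  · rw [Fin.forall_fin_two]
    exact ⟨h1, h2⟩

lemma IsMaxPacking.false_of_three (h : K.IsMaxPacking R 𝒯) {S T : Finset V} (hS : S ∈ 𝒯)
    (hT : T ∈ 𝒯) (f : Fin 9 → V) (hf : Function.Injective f)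
    (hA : ∀ i, f i ∈ S ∪ T ∪ (R \ 𝒯.biUnion id)) (p : Fin 9 → Fin 9) (hp : Function.Injective p)
    (h1 : K.OneEdge (f (p 0)) (f (p 1)) (f (p 2))) (h2 : K.OneEdge (f (p 3)) (f (p 4)) (f (p 5)))
    (h3 : K.OneEdge (f (p 6)) (f (p 7)) (f (p 8))) : False := by
  let q : Fin 3 × Fin 3 → Fin 9 := fun i => ![![0, 1, 2], ![3, 4, 5], ![6, 7, 8]] i.1 i.2
  have hq : Function.Injective q := by decide
  refine h.false_of_injective (𝒮 := {S, T}) (by simp [insert_subset_iff, hS, hT]) (ι := Fin 3)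
    (card_le_two.trans_lt (by simp)) (f ∘ p ∘ q) (hf.comp (hp.comp hq)) ?_ ?_
  · intro i
    have : ({S, T} : Finset (Finset V)).biUnion id = S ∪ T := by simp [biUnion_insert]
    rw [this]
    exact hA _
  · intro i
    fin_cases i
    exacts [h1, h2, h3]

/-- Replacing the triple `T` by another one inside `T` and the uncovered vertices. -/
lemma IsMaxPacking.swap (h : K.IsMaxPacking R 𝒯) {T : Finset V} (hT : T ∈ 𝒯) (f : Fin 6 → V)
    (hf : Function.Injective f) (hA : ∀ i, f i ∈ T ∪ (R \ 𝒯.biUnion id)) (p : Fin 6 → Fin 6)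
    (hp : Function.Injective p) (h1 : K.OneEdge (f (p 0)) (f (p 1)) (f (p 2))) :
    ∃ 𝒯', K.IsMaxPacking R 𝒯' ∧ #𝒯' = #𝒯 ∧ (∀ S ∈ 𝒯, S ≠ T → S ∈ 𝒯') ∧
      f (p 3) ∈ R \ 𝒯'.biUnion id ∧ f (p 4) ∈ R \ 𝒯'.biUnion id ∧
      f (p 5) ∈ R \ 𝒯'.biUnion id ∧ {f (p 0), f (p 1), f (p 2)} ∈ 𝒯' := by
  let q : Fin 1 × Fin 3 → Fin 6 := fun i => ![0, 1, 2] i.2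
  have hq : Function.Injective q := by decide
  have hs : ({T} : Finset (Finset V)) ⊆ 𝒯 := singleton_subset_iff.2 hT
  obtain ⟨𝒮', h2, h3, h4⟩ := exists_isPacking_of_injective (K := K)
    (A := ({T} : Finset (Finset V)).biUnion id ∪ (R \ 𝒯.biUnion id))
    (f ∘ p ∘ q) (hf.comp (hp.comp hq)) (fun i => by rw [singleton_biUnion]; exact hA _)
    (fun i => h1)
  have h5 := h.1.exchange hs h2
  have h6 := h.1.card_exchange hs h2
  have h7 : #(𝒯 \ {T} ∪ 𝒮') = #𝒯 := by simp at h3 h6; omega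
  have hR : ∀ i, f i ∈ R := by
    intro i
    rcases mem_union.1 (hA i) with hi | hi
    · exact h.1.subset T hT hi
    · exact (mem_sdiff.1 hi).1
  have hout : ∀ j, (∀ i, q i ≠ j) → f (p j) ∈ R \ (𝒯 \ {T} ∪ 𝒮').biUnion id := by
    intro j hj
    refine mem_sdiff.2 ⟨hR _, fun hmem => ?_⟩
    rw [union_biUnion, mem_union] at hmem
    rcases hmem with hmem | hmem
    · obtain ⟨S, hS, hx⟩ := mem_biUnion.1 hmem
      rw [mem_sdiff, mem_singleton] at hS
      rcases mem_union.1 (hA (p j)) with hi | hi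
      · exact Finset.disjoint_left.1 (h.1.disj _ hS.1 _ hT hS.2) hx hi
      · exact (mem_sdiff.1 hi).2 (mem_biUnion.2 ⟨S, hS.1, hx⟩)
    · rw [h4] at hmem
      obtain ⟨i, -, hi⟩ := mem_image.1 hmem
      exact hj i (hp (hf hi))
  refine ⟨_, ⟨h5, fun 𝒯' h' => by rw [h7]; exact h.2 _ h'⟩, h7, ?_, hout 3 (by decide),
    hout 4 (by decide), hout 5 (by decide), ?_⟩
  · intro S hS hne
    simp [hS, hne]
  · rw [mem_union]
    right
    obtain ⟨T', rfl⟩ := card_eq_one.1 (h3.trans (by simp))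
    rw [mem_singleton]
    have h8 : T' = univ.image (f ∘ p ∘ q) := by simpa using h4
    rw [h8]
    ext x
    simp [q, Prod.exists, Fin.exists_fin_succ, eq_comm]

end SimpleGraph

/-! ### Adjacency patterns between an uncovered path and a triple -/

namespace SimpleGraph

variable {V : Type*} {K : SimpleGraph V}

/-- Exactly one of three booleans is true. -/
def exactlyOne (p q r : Bool) : Bool := (p && !q && !r) || (q && !p && !r) || (r && !p && !q)

lemma oneEdge_iff [DecidableRel K.Adj] {x y z : V} : K.OneEdge x y z ↔
    exactlyOne (decide (K.Adj x y)) (decide (K.Adj x z)) (decide (K.Adj y z)) = true := by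
  simp [OneEdge, exactlyOne, and_assoc, or_assoc]

lemma injective_six {a b c u v w : V} (h : [a, b, c].Nodup) (h' : [u, v, w].Nodup)
    (hd : ∀ x ∈ [a, b, c], x ∉ [u, v, w]) : Function.Injective ![a, b, c, u, v, w] := by
  rw [← List.nodup_ofFn]
  exact List.Nodup.append h h' fun x hx hx' => hd x hx hx'

lemma injective_nine {a b c u v w x y z : V} (h : [a, b, c].Nodup) (h' : [u, v, w].Nodup)
    (h'' : [x, y, z].Nodup)
    (hd : ∀ r ∈ [a, b, c], r ∉ [u, v, w]) (hd' : ∀ r ∈ [a, b, c], r ∉ [x, y, z])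
    (hd'' : ∀ r ∈ [u, v, w], r ∉ [x, y, z]) :
    Function.Injective ![a, b, c, u, v, w, x, y, z] := by
  rw [← List.nodup_ofFn]
  refine List.Nodup.append (l₁ := [a, b, c]) (l₂ := [u, v, w, x, y, z]) h
    (List.Nodup.append (l₁ := [u, v, w]) (l₂ := [x, y, z]) h' h'' fun r hr hr' => hd'' r hr hr') ?_
  intro r hr hr'
  rcases (List.mem_append (s := [u, v, w]) (t := [x, y, z])).1 hr' with h1 | h1
  · exact hd r hr h1
  · exact hd' r hr h1

variable [DecidableEq V] {R : Finset V} {𝒯 : Finset (Finset V)}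

/-- `{u, v, w}` is a member of `𝒯`, with `uv` the only edge it spans. -/
structure IsTriple (K : SimpleGraph V) (𝒯 : Finset (Finset V)) (u v w : V) : Prop where
  mem : {u, v, w} ∈ 𝒯
  adj : K.Adj u v
  left : ¬K.Adj u w
  right : ¬K.Adj v w

lemma IsTriple.symm {u v w : V} (h : K.IsTriple 𝒯 u v w) : K.IsTriple 𝒯 v u w :=
  ⟨by rw [insert_comm]; exact h.mem, h.adj.symm, h.right, h.left⟩

lemma IsTriple.nodup {u v w : V} (h : K.IsTriple 𝒯 u v w) : [u, v, w].Nodup := by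
  have h1 := h.adj.ne
  have h2 : u ≠ w := by rintro rfl; exact h.right h.adj.symm
  have h3 : v ≠ w := by rintro rfl; exact h.left h.adj
  simp [h1, h2, h3]

lemma IsPacking.exists_isTriple (h : K.IsPacking R 𝒯) {T : Finset V} (hT : T ∈ 𝒯) :
    ∃ u v w, T = {u, v, w} ∧ K.IsTriple 𝒯 u v w := by
  obtain ⟨u, v, w, rfl, h1, h2, h3⟩ := h.oneEdge T hT
  exact ⟨u, v, w, rfl, hT, h1, h2, h3⟩

lemma IsTriple.notMem {u v w a : V} (h : K.IsTriple 𝒯 u v w) (ha : a ∈ R \ 𝒯.biUnion id) :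
    a ∉ [u, v, w] := by
  intro h'
  exact (mem_sdiff.1 ha).2 (mem_biUnion.2 ⟨_, h.mem, by simpa using h'⟩)

lemma IsTriple.injective_six {u v w a b c : V} (h : K.IsTriple 𝒯 u v w)
    (ha : a ∈ R \ 𝒯.biUnion id) (hb : b ∈ R \ 𝒯.biUnion id) (hc : c ∈ R \ 𝒯.biUnion id)
    (hn : [a, b, c].Nodup) : Function.Injective ![a, b, c, u, v, w] := by
  refine SimpleGraph.injective_six hn h.nodup fun x hx => h.notMem (R := R) ?_
  simp only [List.mem_cons, List.not_mem_nil, or_false] at hx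
  rcases hx with rfl | rfl | rfl <;> assumption

lemma IsTriple.mem_six {u v w a b c : V} (ha : a ∈ R \ 𝒯.biUnion id)
    (hb : b ∈ R \ 𝒯.biUnion id) (hc : c ∈ R \ 𝒯.biUnion id) :
    ∀ i, ![a, b, c, u, v, w] i ∈ {u, v, w} ∪ (R \ 𝒯.biUnion id) := by
  intro i
  rw [mem_union]
  fin_cases i
  · exact Or.inr ha
  · exact Or.inr hb
  · exact Or.inr hc
  · exact Or.inl (by simp)
  · exact Or.inl (by simp)
  · exact Or.inl (by simp)

lemma IsTriple.disjoint {u v w x y z : V} (hP : K.IsPacking R 𝒯) (h : K.IsTriple 𝒯 u v w)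
    (h' : K.IsTriple 𝒯 x y z) (hne : ({u, v, w} : Finset V) ≠ {x, y, z}) :
    ∀ r ∈ [u, v, w], r ∉ [x, y, z] := by
  intro r hr hr'
  exact Finset.disjoint_left.1 (hP.disj _ h.mem _ h'.mem hne)
    (by simpa using hr : r ∈ ({u, v, w} : Finset V)) (by simpa using hr')

lemma IsTriple.injective_nine {u v w x y z a b c : V} (hP : K.IsPacking R 𝒯)
    (h : K.IsTriple 𝒯 u v w) (h' : K.IsTriple 𝒯 x y z)
    (hne : ({u, v, w} : Finset V) ≠ {x, y, z})
    (ha : a ∈ R \ 𝒯.biUnion id) (hb : b ∈ R \ 𝒯.biUnion id) (hc : c ∈ R \ 𝒯.biUnion id)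
    (hn : [a, b, c].Nodup) : Function.Injective ![a, b, c, u, v, w, x, y, z] := by
  have key : ∀ r ∈ [a, b, c], r ∈ R \ 𝒯.biUnion id := by
    intro r hr
    simp only [List.mem_cons, List.not_mem_nil, or_false] at hr
    rcases hr with rfl | rfl | rfl <;> assumption
  exact SimpleGraph.injective_nine hn h.nodup h'.nodup (fun r hr => h.notMem (key r hr))
    (fun r hr => h'.notMem (key r hr)) (IsTriple.disjoint hP h h' hne)

lemma IsTriple.mem_nine {u v w x y z a b c : V} (ha : a ∈ R \ 𝒯.biUnion id)
    (hb : b ∈ R \ 𝒯.biUnion id) (hc : c ∈ R \ 𝒯.biUnion id) :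
    ∀ i, ![a, b, c, u, v, w, x, y, z] i ∈ {u, v, w} ∪ {x, y, z} ∪ (R \ 𝒯.biUnion id) := by
  intro i
  rw [mem_union, mem_union]
  fin_cases i
  · exact Or.inr ha
  · exact Or.inr hb
  · exact Or.inr hc
  · exact Or.inl (Or.inl (by simp))
  · exact Or.inl (Or.inl (by simp))
  · exact Or.inl (Or.inl (by simp))
  · exact Or.inl (Or.inr (by simp))
  · exact Or.inl (Or.inr (by simp))
  · exact Or.inl (Or.inr (by simp))

/-- The possible adjacencies between an uncovered path `abc` and a triple `uv|w` of a maximum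
packing in a triangle-free graph. -/
def pathPattern (au av aw bu bv bw cu cv cw : Bool) : Bool :=
  !(au && bu) && !(av && bv) && !(aw && bw) && !(bu && cu) && !(bv && cv) && !(bw && cw) &&
  !(au && av) && !(bu && bv) && !(cu && cv) &&
  !(exactlyOne true au bu && exactlyOne cv cw false) &&
  !(exactlyOne true av bv && exactlyOne cu cw false) &&
  !(exactlyOne true aw bw && exactlyOne cu cv true) &&
  !(exactlyOne false au cu && exactlyOne bv bw false) &&
  !(exactlyOne false av cv && exactlyOne bu bw false) &&
  !(exactlyOne false aw cw && exactlyOne bu bv true) &&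
  !(exactlyOne au av true && exactlyOne true bw cw) &&
  !(exactlyOne au aw false && exactlyOne true bv cv) &&
  !(exactlyOne av aw false && exactlyOne true bu cu)

/-- The edges between the path `abc` and the triple `uv|w` close up a five-cycle. -/
def wheelPattern (au av aw bu bv bw cu cv cw : Bool) : Bool :=
  !aw && !bu && !bv && !bw && !cw &&
    ((au && !av && !cu && cv) || (!au && av && cu && !cv))

-- Counting the edges at the middle vertex twice makes 4 the critical average: a degree count in
-- `not_adj` finds a triple of weight below 4, which must be one of the two exceptions.
set_option synthInstance.maxSize 1000 in
lemma pathPattern_weight : ∀ au av aw bu bv bw cu cv cw : Bool,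
    pathPattern au av aw bu bv bw cu cv cw →
    4 ≤ (au.toNat + av.toNat + aw.toNat) + 2 * (bu.toNat + bv.toNat + bw.toNat) +
      (cu.toNat + cv.toNat + cw.toNat) ∨
    (bw = true ∧ au = false ∧ av = false ∧ aw = false ∧ bu = false ∧ bv = false ∧ cu = false ∧
      cv = false ∧ cw = false) ∨
    wheelPattern au av aw bu bv bw cu cv cw = true := by
  decide

lemma pathPattern_of_middle : ∀ au av aw cu cv cw : Bool,
    pathPattern au av aw false false false cu cv cw →
    (au = true ∧ aw = true ∧ cu = true ∧ cw = true) ∨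
    (av = true ∧ aw = true ∧ cv = true ∧ cw = true) ∨
    wheelPattern au av aw false false false cu cv cw = true := by
  decide

/-- The five premises concern the five three-vertex subpaths of a five-cycle, each facing the same
triple. Nesting the quantifiers lets `decide` prune the search. -/
lemma not_pathPattern_cycle : ∀ u₀ v₀ w₀ u₁ v₁ w₁ u₂ v₂ w₂ : Bool,
    pathPattern u₀ v₀ w₀ u₁ v₁ w₁ u₂ v₂ w₂ →
    ∀ u₃ v₃ w₃ : Bool, pathPattern u₁ v₁ w₁ u₂ v₂ w₂ u₃ v₃ w₃ →
    ∀ u₄ v₄ w₄ : Bool, pathPattern u₂ v₂ w₂ u₃ v₃ w₃ u₄ v₄ w₄ →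
    pathPattern u₃ v₃ w₃ u₄ v₄ w₄ u₀ v₀ w₀ →
    ¬pathPattern u₄ v₄ w₄ u₀ v₀ w₀ u₁ v₁ w₁ := by
  decide

variable [DecidableRel K.Adj]

/-- Six vertices split into two triples in ten ways. The split `abc|uvw` says nothing, since `abc`
spans two edges; the other nine must fail by maximality. -/
lemma IsMaxPacking.pathPattern_of_adj (h : K.IsMaxPacking R 𝒯)
    (htri : ∀ x y z, K.Adj x y → K.Adj x z → ¬K.Adj y z) {u v w a b c : V}
    (hT : K.IsTriple 𝒯 u v w) (ha : a ∈ R \ 𝒯.biUnion id) (hb : b ∈ R \ 𝒯.biUnion id)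
    (hc : c ∈ R \ 𝒯.biUnion id) (hab : K.Adj a b) (hbc : K.Adj b c) (hne : a ≠ c) :
    pathPattern (K.Adj a u) (K.Adj a v) (K.Adj a w) (K.Adj b u) (K.Adj b v) (K.Adj b w)
      (K.Adj c u) (K.Adj c v) (K.Adj c w) := by
  have hac : ¬K.Adj a c := htri b a c hab.symm hbc
  have hf := hT.injective_six ha hb hc (by simp [hab.ne, hbc.ne, hne])
  have key := h.false_of_two hT.mem ![a, b, c, u, v, w] hf (IsTriple.mem_six ha hb hc)
  have k1 := key ![0, 1, 3, 2, 4, 5] (by decide)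
  have k2 := key ![0, 1, 4, 2, 3, 5] (by decide)
  have k3 := key ![0, 1, 5, 2, 3, 4] (by decide)
  have k4 := key ![0, 2, 3, 1, 4, 5] (by decide)
  have k5 := key ![0, 2, 4, 1, 3, 5] (by decide)
  have k6 := key ![0, 2, 5, 1, 3, 4] (by decide)
  have k7 := key ![0, 3, 4, 1, 2, 5] (by decide)
  have k8 := key ![0, 3, 5, 1, 2, 4] (by decide)
  have k9 := key ![0, 4, 5, 1, 2, 3] (by decide)
  simp only [oneEdge_iff] at k1 k2 k3 k4 k5 k6 k7 k8 k9
  simp [hab, hbc, hac, hT.adj, hT.left, hT.right] at k1 k2 k3 k4 k5 k6 k7 k8 k9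
  have nb : ∀ p q : Bool, (p = true → ¬q = true) → (!(p && q)) = true := by decide
  have nt : ∀ {p q : Prop} [Decidable p] [Decidable q], (p → ¬q) →
      (!(decide p && decide q)) = true := fun h' => nb _ _ (by simpa using h')
  have nk : ∀ p q : Bool, (p = true → q = false) → (!(p && q)) = true := by decide
  simp only [SimpleGraph.pathPattern, Bool.and_eq_true, and_assoc]
  exact ⟨nt fun h1 h2 => htri _ _ _ hab h1 h2, nt fun h1 h2 => htri _ _ _ hab h1 h2,
    nt fun h1 h2 => htri _ _ _ hab h1 h2, nt fun h1 h2 => htri _ _ _ hbc h1 h2,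
    nt fun h1 h2 => htri _ _ _ hbc h1 h2, nt fun h1 h2 => htri _ _ _ hbc h1 h2,
    nt fun h1 h2 => htri _ _ _ h1 h2 hT.adj, nt fun h1 h2 => htri _ _ _ h1 h2 hT.adj,
    nt fun h1 h2 => htri _ _ _ h1 h2 hT.adj, nk _ _ k1, nk _ _ k2, nk _ _ k3, nk _ _ k4, nk _ _ k5,
    nk _ _ k6, nk _ _ k7, nk _ _ k8, nk _ _ k9⟩

end SimpleGraph

/-! ### The uncovered vertices form an independent set -/

namespace SimpleGraph

variable {V : Type*} {K : SimpleGraph V} [DecidableEq V] [DecidableRel K.Adj]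
variable {R : Finset V} {𝒯 : Finset (Finset V)}

/-- Pendant at the middle vertex of the path and a triple whose ends dominate its outer vertices
cannot occur together. -/
lemma IsMaxPacking.false_of_pendant (h : K.IsMaxPacking R 𝒯)
    (htri : ∀ x y z, K.Adj x y → K.Adj x z → ¬K.Adj y z) {u v w x y z a b c : V}
    (hT : K.IsTriple 𝒯 u v w) (hS : K.IsTriple 𝒯 x y z)
    (hne : ({u, v, w} : Finset V) ≠ {x, y, z})
    (ha : a ∈ R \ 𝒯.biUnion id) (hb : b ∈ R \ 𝒯.biUnion id)
    (hc : c ∈ R \ 𝒯.biUnion id) (hab : K.Adj a b) (hbc : K.Adj b c) (hac : a ≠ c)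
    (hau : ¬K.Adj a u) (hav : ¬K.Adj a v) (hbv : ¬K.Adj b v) (hbu : ¬K.Adj b u) (hbw : K.Adj b w)
    (hax : K.Adj a x) (hcy : ¬K.Adj c y) (hcz : K.Adj c z) : False := by
  have hf := IsTriple.injective_nine h.1 hT hS hne ha hb hc (by simp [hab.ne, hbc.ne, hac])
  have key := h.false_of_three hT.mem hS.mem ![a, b, c, u, v, w, x, y, z] hf
    (IsTriple.mem_nine ha hb hc)
  have huv := hT.adj
  have hxy := hS.adj
  have hxz := hS.left
  have hyz := hS.right
  -- In both regroupings the triples at `b` and `c` span one edge, so the triple at `a` must fail.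
  -- This forces `x` to be adjacent to both `u` and `v`, giving a triangle.
  have k1 : K.OneEdge a u x → K.OneEdge b v w → K.OneEdge c y z → False :=
    key ![0, 3, 6, 1, 4, 5, 2, 7, 8] (by decide)
  have k2 : K.OneEdge a v x → K.OneEdge b u w → K.OneEdge c y z → False :=
    key ![0, 4, 6, 1, 3, 5, 2, 7, 8] (by decide)
  have h1 : K.OneEdge c y z := Or.inr (Or.inl ⟨hcz, hcy, hyz⟩)
  have h2 : K.OneEdge b v w := Or.inr (Or.inl ⟨hbw, hbv, hT.right⟩)
  have h3 : K.OneEdge b u w := Or.inr (Or.inl ⟨hbw, hbu, hT.left⟩)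
  have h4 : K.Adj u x := by
    by_contra h4
    exact k1 (Or.inr (Or.inl ⟨hax, hau, h4⟩)) h2 h1
  have h5 : K.Adj v x := by
    by_contra h5
    exact k2 (Or.inr (Or.inl ⟨hax, hav, h5⟩)) h3 h1
  exact htri u v x huv h4 h5

/-- An uncovered path closing up a five-cycle with a triple obstructs every other triple. -/
lemma IsMaxPacking.false_of_wheel (h : K.IsMaxPacking R 𝒯)
    (htri : ∀ x y z, K.Adj x y → K.Adj x z → ¬K.Adj y z) {u v w r s t a b c : V}
    (hT : K.IsTriple 𝒯 u v w) (hS : K.IsTriple 𝒯 r s t)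
    (hne : ({r, s, t} : Finset V) ≠ {u, v, w})
    (ha : a ∈ R \ 𝒯.biUnion id) (hb : b ∈ R \ 𝒯.biUnion id)
    (hc : c ∈ R \ 𝒯.biUnion id) (hab : K.Adj a b) (hbc : K.Adj b c) (hac : a ≠ c)
    (haw : ¬K.Adj a w) (hbw : ¬K.Adj b w) (hcw : ¬K.Adj c w)
    (hau : K.Adj a u) (hcv : K.Adj c v) : False := by
  have hf := hT.injective_six ha hb hc (by simp [hab.ne, hbc.ne, hac])
  have hA := IsTriple.mem_six (R := R) (𝒯 := 𝒯) (u := u) (v := v) (w := w) ha hb hc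
  have hf' : ∀ i j : Fin 6, i ≠ j → ![a, b, c, u, v, w] i ≠ ![a, b, c, u, v, w] j :=
    fun i j hij h' => hij (hf h')
  -- In the five-cycle `a b c v u`, each edge `x₀x₁` spans a one-edge triple with `w`. Swapping it
  -- for `uvw` uncovers the opposite path `x₂x₃x₄`, which must then obey `pathPattern` against
  -- `rst`.
  have key : ∀ p : Fin 6 → Fin 6, Function.Injective p →
      ∀ x₀ x₁ x₂ x₃ x₄, (∀ i, ![x₀, x₁, w, x₂, x₃, x₄] i = ![a, b, c, u, v, w] (p i)) →
      K.Adj x₀ x₁ → ¬K.Adj x₀ w → ¬K.Adj x₁ w → K.Adj x₂ x₃ → K.Adj x₃ x₄ →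
      pathPattern (K.Adj x₂ r) (K.Adj x₂ s) (K.Adj x₂ t) (K.Adj x₃ r) (K.Adj x₃ s) (K.Adj x₃ t)
        (K.Adj x₄ r) (K.Adj x₄ s) (K.Adj x₄ t) := by
    intro p hp x₀ x₁ x₂ x₃ x₄ hx h01 h0w h1w h23 h34
    have e0 : x₀ = _ := hx 0
    have e1 : x₁ = _ := hx 1
    have e2 : w = _ := hx 2
    have e3 : x₂ = _ := hx 3
    have e4 : x₃ = _ := hx 4
    have e5 : x₄ = _ := hx 5
    obtain ⟨𝒯', h1, -, h2, h3, h4, h5, -⟩ := h.swap hT.mem _ hf hA p hp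
      (by rw [← e0, ← e1, ← e2]; exact Or.inl ⟨h01, h0w, h1w⟩)
    rw [← e3] at h3
    rw [← e4] at h4
    rw [← e5] at h5
    have hS' : K.IsTriple 𝒯' r s t := ⟨h2 _ hS.mem hne, hS.adj, hS.left, hS.right⟩
    refine h1.pathPattern_of_adj htri hS' h3 h4 h5 h23 h34 ?_
    rw [e3, e5]
    exact fun h' => absurd (hp (hf h')) (by decide)
  have q0 := h.pathPattern_of_adj htri hS ha hb hc hab hbc hac
  have q1 := key ![0, 3, 5, 1, 2, 4] (by decide) a u b c v (by intro i; fin_cases i <;> rfl)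
    hau haw hT.left hbc hcv
  have q2 := key ![0, 1, 5, 2, 4, 3] (by decide) a b c v u (by intro i; fin_cases i <;> rfl)
    hab haw hbw hcv hT.adj.symm
  have q3 := key ![1, 2, 5, 4, 3, 0] (by decide) b c v u a (by intro i; fin_cases i <;> rfl)
    hbc hbw hcw hT.adj.symm hau.symm
  have q4 := key ![2, 4, 5, 3, 0, 1] (by decide) c v u a b (by intro i; fin_cases i <;> rfl)
    hcv hcw hT.right hau.symm hab
  exact not_pathPattern_cycle _ _ _ _ _ _ _ _ _ q0 _ _ _ q1 _ _ _ q2 q3 q4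

lemma IsTriple.card_filter_adj {u v w : V} (h : K.IsTriple 𝒯 u v w) (a : V) :
    #(({u, v, w} : Finset V).filter (K.Adj a)) =
      (decide (K.Adj a u)).toNat + (decide (K.Adj a v)).toNat + (decide (K.Adj a w)).toNat := by
  have hn := h.nodup
  simp only [List.nodup_cons, List.mem_cons, List.not_mem_nil, or_false, not_or] at hn
  have h1 := hn.1.1
  have h2 := hn.1.2
  have h3 := hn.2.1
  by_cases hu : K.Adj a u <;> by_cases hv : K.Adj a v <;> by_cases hw : K.Adj a w <;>
    simp [filter_insert, filter_singleton, hu, hv, hw, h1, h2, h3]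

lemma IsPacking.sum_card_filter (h : K.IsPacking R 𝒯) (a : V) :
    ∑ T ∈ 𝒯, #(T.filter (K.Adj a)) + #((R \ 𝒯.biUnion id).filter (K.Adj a)) =
      #(R.filter (K.Adj a)) := by
  have h1 : ∑ T ∈ 𝒯, #(T.filter (K.Adj a)) = #((𝒯.biUnion id).filter (K.Adj a)) := by
    rw [filter_biUnion, Finset.card_biUnion]
    · rfl
    · intro S hS T hT hne
      exact disjoint_filter_filter (h.disj S hS T hT hne)
  rw [h1, ← card_union_of_disjoint, ← filter_union, union_sdiff_of_subset h.biUnion_subset]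
  exact disjoint_filter_filter disjoint_sdiff

/-- In a maximum packing that is not perfect, the uncovered vertices are pairwise non-adjacent. -/
lemma IsMaxPacking.not_adj (h : K.IsMaxPacking R 𝒯)
    (htri : ∀ x y z, K.Adj x y → K.Adj x z → ¬K.Adj y z) {k : ℕ}
    (hα : ∀ I : Finset V, (∀ x ∈ I, ∀ y ∈ I, ¬K.Adj x y) → #I ≤ k) (hR : #R = 3 * k)
    (hk : 4 ≤ k) (ht : #𝒯 < k) :
    ∀ x ∈ R \ 𝒯.biUnion id, ∀ y ∈ R \ 𝒯.biUnion id, ¬K.Adj x y := by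
  set L := R \ 𝒯.biUnion id with hL
  have hdeg : ∀ x (A : Finset V), #(A.filter (K.Adj x)) ≤ k := by
    intro x A
    refine hα _ fun y hy z hz => htri x y z (mem_filter.1 hy).2 (mem_filter.1 hz).2
  have hcard : #L + 3 * #𝒯 = 3 * k := by
    rw [hL, ← h.1.card_biUnion, ← hR]
    exact card_sdiff_add_card_eq_card h.1.biUnion_subset
  -- No one-edge triple fits inside `L`, so each vertex of `L` is adjacent to exactly one end of an
  -- edge of `L`.
  have hsum : ∀ x ∈ L, ∀ y ∈ L, K.Adj x y → #(L.filter (K.Adj x)) + #(L.filter (K.Adj y)) = #L := by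
    intro x hx y hy hxy
    rw [← card_union_of_disjoint]
    · congr 1
      ext z
      simp only [mem_union, mem_filter]
      refine ⟨fun hz => hz.elim And.left And.left, fun hz => ?_⟩
      by_contra hcon
      push Not at hcon
      exact h.false_of_one hx hy hz hxy (hcon.1 hz) (hcon.2 hz)
    · rw [Finset.disjoint_left]
      intro z hz hz'
      exact htri x y z hxy (mem_filter.1 hz).2 (mem_filter.1 hz').2
  suffices main : ∀ b ∈ L, ∀ a ∈ L, K.Adj b a →
      #(L.filter (K.Adj a)) ≤ #(L.filter (K.Adj b)) → False by
    intro x hx y hy hxy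
    rcases le_total #(L.filter (K.Adj y)) #(L.filter (K.Adj x)) with h' | h'
    · exact main x hx y hy hxy h'
    · exact main y hy x hx hxy.symm h'
  intro b hb a ha hba hle
  have hs1 := hsum b hb a ha hba
  obtain ⟨c, hc, hca⟩ : ∃ c ∈ L.filter (K.Adj b), c ≠ a :=
    exists_mem_ne (by omega) a
  obtain ⟨hcL, hbc⟩ := mem_filter.1 hc
  have hs2 := hsum b hb c hcL hbc
  have eb := h.1.sum_card_filter b
  have ea := h.1.sum_card_filter a
  have ec := h.1.sum_card_filter c
  rw [← hL] at ea eb ec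
  have da := hdeg a R
  have db := hdeg b R
  have dc := hdeg c R
  have db' := hdeg b L
  have da' := hdeg a L
  -- At least half of `L`, hence more than `k - #𝒯` vertices, are neighbours of `b` in `L`, so fewer
  -- than `#𝒯` neighbours remain for the triples.
  obtain ⟨T₀, hT₀, hb₀⟩ : ∃ T ∈ 𝒯, #(T.filter (K.Adj b)) < 1 := by
    refine exists_lt_of_sum_lt ?_
    rw [sum_const, smul_eq_mul, mul_one]
    omega
  -- The total weight is at most `4k - 2#L = 6#𝒯 - 2k`, which is less than `4#𝒯`.
  obtain ⟨T₁, hT₁, hw₁⟩ : ∃ T ∈ 𝒯, #(T.filter (K.Adj a)) + 2 * #(T.filter (K.Adj b)) +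
      #(T.filter (K.Adj c)) < 4 := by
    refine exists_lt_of_sum_lt ?_
    rw [sum_const, smul_eq_mul, sum_add_distrib, sum_add_distrib, ← mul_sum]
    omega
  have hwheel : ∀ T ∈ 𝒯, ∀ u v w, T = {u, v, w} → K.IsTriple 𝒯 u v w →
      wheelPattern (K.Adj a u) (K.Adj a v) (K.Adj a w) (K.Adj b u) (K.Adj b v) (K.Adj b w)
        (K.Adj c u) (K.Adj c v) (K.Adj c w) = true → False := by
    rintro T hT u v w rfl huvw hp
    -- A second triple exists because `#L ≤ 2k` gives `3#𝒯 ≥ k ≥ 4`.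
    obtain ⟨S, hS, hST⟩ := exists_mem_ne (by omega : 1 < #𝒯) ({u, v, w} : Finset V)
    obtain ⟨r, s, t, rfl, hrst⟩ := h.1.exists_isTriple hS
    simp only [wheelPattern, Bool.and_eq_true, Bool.or_eq_true, Bool.not_eq_true',
      decide_eq_true_eq, decide_eq_false_iff_not] at hp
    obtain ⟨⟨⟨⟨⟨haw, hbu⟩, hbv⟩, hbw⟩, hcw⟩, hp⟩ := hp
    rcases hp with hp | hp
    · exact h.false_of_wheel htri huvw hrst hST ha hb hcL hba.symm hbc hca.symm haw hbw hcw
        hp.1.1.1 hp.2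
    · have : ({v, u, w} : Finset V) = {u, v, w} := insert_comm _ _ _
      exact h.false_of_wheel htri huvw.symm hrst (by rwa [this]) ha hb hcL hba.symm hbc hca.symm
        haw hbw hcw hp.1.1.2 hp.1.2
  obtain ⟨u, v, w, rfl, huvw⟩ := h.1.exists_isTriple hT₁
  obtain ⟨x, y, z, rfl, hxyz⟩ := h.1.exists_isTriple hT₀
  have p1 := h.pathPattern_of_adj htri huvw ha hb hcL hba.symm hbc hca.symm
  have p0 := h.pathPattern_of_adj htri hxyz ha hb hcL hba.symm hbc hca.symm
  rw [huvw.card_filter_adj, huvw.card_filter_adj, huvw.card_filter_adj] at hw₁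
  have hbx : ¬K.Adj b x ∧ ¬K.Adj b y ∧ ¬K.Adj b z := by
    have h0 := card_eq_zero.1 (Nat.lt_one_iff.1 hb₀)
    simpa [filter_eq_empty_iff] using h0
  simp only [hbx.1, hbx.2.1, hbx.2.2, decide_false] at p0
  rcases pathPattern_weight _ _ _ _ _ _ _ _ _ p1 with q1 | q1 | q1
  · omega
  · simp only [decide_eq_true_eq, decide_eq_false_iff_not] at q1
    obtain ⟨hbw, hau, hav, haw, hbu, hbv, hcu, hcv, hcw⟩ := q1
    have hne : ({u, v, w} : Finset V) ≠ {x, y, z} := by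
      intro heq
      have : w ∈ ({x, y, z} : Finset V) := by rw [← heq]; simp
      simp only [mem_insert, mem_singleton] at this
      rcases this with rfl | rfl | rfl
      exacts [hbx.1 hbw, hbx.2.1 hbw, hbx.2.2 hbw]
    rcases pathPattern_of_middle _ _ _ _ _ _ p0 with q0 | q0 | q0
    · simp only [decide_eq_true_eq] at q0
      exact h.false_of_pendant htri huvw hxyz hne ha hb hcL hba.symm hbc hca.symm hau hav hbv hbu
        hbw q0.1 (htri x c y q0.2.2.1.symm hxyz.adj) q0.2.2.2
    · simp only [decide_eq_true_eq] at q0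
      have : ({y, x, z} : Finset V) = {x, y, z} := insert_comm _ _ _
      exact h.false_of_pendant htri huvw hxyz.symm (by rwa [this]) ha hb hcL hba.symm hbc hca.symm
        hau hav hbv hbu hbw q0.1 (htri y c x q0.2.2.1.symm hxyz.symm.adj) q0.2.2.2
    · exact hwheel _ hT₀ x y z rfl hxyz (by
        simpa only [hbx.1, hbx.2.1, hbx.2.2, decide_false] using q0)
  · exact hwheel _ hT₁ u v w rfl huvw q1

end SimpleGraph

/-! ### Maximum packings are perfect -/

namespace SimpleGraph

/-- The triples `{x, y, z}` and `{x', y', z'}` with the given adjacencies are compatible with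
every maximum packing leaving an independent set uncovered. -/
def swapPattern (p q r p' q' r' : Bool) : Bool :=
  !(exactlyOne p q r && (p' || q' || r')) && !(exactlyOne p' q' r' && (p || q || r))

set_option synthInstance.maxSize 1000 in
lemma swapPattern_apex : ∀ au av aw bu bv bw cu cv cw : Bool,
    !(au && av) → !(bu && bv) → !(cu && cv) →
    swapPattern false au bu cv cw false → swapPattern false av bv cu cw false →
    swapPattern false aw bw cu cv true → swapPattern false au cu bv bw false →
    swapPattern false av cv bu bw false → swapPattern false aw cw bu bv true →
    swapPattern au av true false bw cw → swapPattern au aw false false bv cv →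
    swapPattern av aw false false bu cu → aw = false := by
  decide

variable {V : Type*} {K : SimpleGraph V} [DecidableEq V] [DecidableRel K.Adj]
variable {R : Finset V} {𝒯 : Finset (Finset V)}

lemma IsMaxPacking.swapPattern_of_injective (h : K.IsMaxPacking R 𝒯)
    (hind : ∀ 𝒯', K.IsMaxPacking R 𝒯' → ∀ x ∈ R \ 𝒯'.biUnion id, ∀ y ∈ R \ 𝒯'.biUnion id,
      ¬K.Adj x y) {T : Finset V} (hT : T ∈ 𝒯) (f : Fin 6 → V) (hf : Function.Injective f)
    (hA : ∀ i, f i ∈ T ∪ (R \ 𝒯.biUnion id)) (p : Fin 6 → Fin 6) (hp : Function.Injective p) :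
    swapPattern (K.Adj (f (p 0)) (f (p 1))) (K.Adj (f (p 0)) (f (p 2)))
      (K.Adj (f (p 1)) (f (p 2))) (K.Adj (f (p 3)) (f (p 4))) (K.Adj (f (p 3)) (f (p 5)))
      (K.Adj (f (p 4)) (f (p 5))) := by
  have key : ∀ p : Fin 6 → Fin 6, Function.Injective p →
      K.OneEdge (f (p 0)) (f (p 1)) (f (p 2)) → ¬K.Adj (f (p 3)) (f (p 4)) ∧
        ¬K.Adj (f (p 3)) (f (p 5)) ∧ ¬K.Adj (f (p 4)) (f (p 5)) := by
    intro p hp h1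
    obtain ⟨𝒯', h2, -, -, h3, h4, h5, -⟩ := h.swap hT f hf hA p hp h1
    exact ⟨hind _ h2 _ h3 _ h4, hind _ h2 _ h3 _ h5, hind _ h2 _ h4 _ h5⟩
  have k1 := key p hp
  have k2 := key (p ∘ ![3, 4, 5, 0, 1, 2]) (hp.comp (by decide))
  rw [oneEdge_iff] at k1 k2
  have nb : ∀ x p q r : Bool, (x = true → p = false ∧ q = false ∧ r = false) →
    (!(x && (p || q || r))) = true := by decide
  simp only [SimpleGraph.swapPattern, Bool.and_eq_true]
  simp only [← decide_eq_false_iff_not] at k1 k2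
  exact ⟨nb _ _ _ _ k1, nb _ _ _ _ k2⟩

/-- Add two further uncovered vertices `b`, `c`. Whenever a split of the six vertices has a one-edge
part, swapping that part in uncovers the other, which must be independent; these constraints exclude
the edge `aw`. -/
lemma IsMaxPacking.not_adj_apex (h : K.IsMaxPacking R 𝒯)
    (htri : ∀ x y z, K.Adj x y → K.Adj x z → ¬K.Adj y z)
    (hind : ∀ 𝒯', K.IsMaxPacking R 𝒯' → ∀ x ∈ R \ 𝒯'.biUnion id, ∀ y ∈ R \ 𝒯'.biUnion id,
      ¬K.Adj x y) {u v w : V} (hT : K.IsTriple 𝒯 u v w) (hL : 3 ≤ #(R \ 𝒯.biUnion id)) {a : V}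
    (ha : a ∈ R \ 𝒯.biUnion id) : ¬K.Adj a w := by
  obtain ⟨b, hb, hba⟩ := exists_mem_ne (by omega : 1 < #(R \ 𝒯.biUnion id)) a
  obtain ⟨c, hc, hca⟩ := exists_mem_ne
    (by rw [card_erase_of_mem ha]; omega : 1 < #((R \ 𝒯.biUnion id).erase a)) b
  obtain ⟨hca', hc⟩ := mem_erase.1 hc
  have hf := hT.injective_six ha hb hc (by simp [hba.symm, hca.symm, hca'.symm])
  have key := h.swapPattern_of_injective hind hT.mem ![a, b, c, u, v, w] hf (IsTriple.mem_six ha hb hc)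
  have hab := hind _ h _ ha _ hb
  have hac := hind _ h _ ha _ hc
  have hbc := hind _ h _ hb _ hc
  have k1 := key ![0, 1, 3, 2, 4, 5] (by decide)
  have k2 := key ![0, 1, 4, 2, 3, 5] (by decide)
  have k3 := key ![0, 1, 5, 2, 3, 4] (by decide)
  have k4 := key ![0, 2, 3, 1, 4, 5] (by decide)
  have k5 := key ![0, 2, 4, 1, 3, 5] (by decide)
  have k6 := key ![0, 2, 5, 1, 3, 4] (by decide)
  have k7 := key ![0, 3, 4, 1, 2, 5] (by decide)
  have k8 := key ![0, 3, 5, 1, 2, 4] (by decide)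
  have k9 := key ![0, 4, 5, 1, 2, 3] (by decide)
  simp [hab, hac, hbc, hT.adj, hT.left, hT.right] at k1 k2 k3 k4 k5 k6 k7 k8 k9
  have nb : ∀ x, (!(decide (K.Adj x u) && decide (K.Adj x v))) = true := by
    intro x
    have := fun h1 h2 => htri x u v h1 h2 hT.adj
    simpa [← imp_iff_not_or] using this
  have := swapPattern_apex _ _ _ _ _ _ _ _ _ (nb a) (nb b) (nb c) k1 k2 k3 k4 k5 k6 k7 k8 k9
  exact decide_eq_false_iff_not.1 this

/-- Each triple of a maximum packing has at most one vertex with uncovered neighbours. -/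
lemma IsMaxPacking.exists_isTriple_not_adj (h : K.IsMaxPacking R 𝒯)
    (htri : ∀ x y z, K.Adj x y → K.Adj x z → ¬K.Adj y z)
    (hind : ∀ 𝒯', K.IsMaxPacking R 𝒯' → ∀ x ∈ R \ 𝒯'.biUnion id, ∀ y ∈ R \ 𝒯'.biUnion id,
      ¬K.Adj x y) (hL : 3 ≤ #(R \ 𝒯.biUnion id)) {T : Finset V} (hT : T ∈ 𝒯) :
    ∃ u v w, T = {u, v, w} ∧ K.IsTriple 𝒯 u v w ∧
      ∀ a ∈ R \ 𝒯.biUnion id, ¬K.Adj a v ∧ ¬K.Adj a w := by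
  obtain ⟨u, v, w, rfl, huvw⟩ := h.1.exists_isTriple hT
  have hw := fun a ha => h.not_adj_apex htri hind huvw hL (a := a) ha
  by_cases hv : ∃ b ∈ R \ 𝒯.biUnion id, K.Adj b v
  · obtain ⟨b, hb, hbv⟩ := hv
    refine ⟨v, u, w, insert_comm _ _ _, huvw.symm, fun a ha => ⟨fun hau => ?_, hw a ha⟩⟩
    rcases eq_or_ne a b with rfl | hab
    · exact htri _ _ _ hau hbv huvw.adj
    obtain ⟨c, hc, hcb⟩ := exists_mem_ne
      (by rw [card_erase_of_mem ha]; omega : 1 < #((R \ 𝒯.biUnion id).erase a)) b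
    obtain ⟨hca, hc⟩ := mem_erase.1 hc
    have hf := huvw.injective_six ha hb hc (by simp [hab, hca.symm, hcb.symm])
    -- Swapping in `a u w` would uncover the adjacent vertices `b` and `v`.
    obtain ⟨𝒯', h2, -, -, h3, h4, -⟩ := h.swap hT _ hf (IsTriple.mem_six ha hb hc)
      ![0, 3, 5, 1, 4, 2] (by decide) (Or.inl ⟨hau, hw a ha, huvw.left⟩)
    exact hind _ h2 _ h3 _ h4 hbv
  · push Not at hv
    exact ⟨u, v, w, rfl, huvw, fun a ha => ⟨hv a ha, hw a ha⟩⟩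

lemma exists_three_of_card_filter {L : Finset V} (hL : 3 ≤ #L) (P Q : V → Prop) [DecidablePred P]
    [DecidablePred Q] (hP : 2 ≤ #(L.filter P)) (hQ : 1 ≤ #(L.filter Q)) :
    ∃ a ∈ L, ∃ b ∈ L, ∃ c ∈ L, P a ∧ Q b ∧ [a, b, c].Nodup := by
  obtain ⟨b, hb⟩ := card_pos.1 (by omega : 0 < #(L.filter Q))
  obtain ⟨a, ha, hab⟩ := exists_mem_ne (by omega : 1 < #(L.filter P)) b
  rw [mem_filter] at ha hb
  obtain ⟨c, hc, hcb⟩ := exists_mem_ne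
    (by rw [card_erase_of_mem ha.1]; omega : 1 < #(L.erase a)) b
  obtain ⟨hca, hc⟩ := mem_erase.1 hc
  exact ⟨a, ha.1, b, hb.1, c, hc, ha.2, hb.2, by simp [hab, hca.symm, hcb.symm]⟩

/-- One vertex `f T` per triple is chosen so that `L` together with these vertices is independent;
an edge between two chosen vertices would let two triples be repacked into three. -/
lemma IsMaxPacking.card_eq (h : K.IsMaxPacking R 𝒯)
    (htri : ∀ x y z, K.Adj x y → K.Adj x z → ¬K.Adj y z) {k : ℕ}
    (hα : ∀ I : Finset V, (∀ x ∈ I, ∀ y ∈ I, ¬K.Adj x y) → #I ≤ k) (hR : #R = 3 * k)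
    (hk : 4 ≤ k) : #𝒯 = k := by
  have hcard : #(R \ 𝒯.biUnion id) + 3 * #𝒯 = 3 * k := by
    rw [← h.1.card_biUnion, ← hR]
    exact card_sdiff_add_card_eq_card h.1.biUnion_subset
  by_contra hne
  have ht : #𝒯 < k := by omega
  have hL : 3 ≤ #(R \ 𝒯.biUnion id) := by omega
  have hind : ∀ 𝒯', K.IsMaxPacking R 𝒯' → ∀ x ∈ R \ 𝒯'.biUnion id, ∀ y ∈ R \ 𝒯'.biUnion id,
      ¬K.Adj x y := fun 𝒯' h' => h'.not_adj htri hα hR hk ((h.2 _ h'.1).trans_lt ht)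
  obtain ⟨x₀, -⟩ := card_pos.1 (by omega : 0 < #(R \ 𝒯.biUnion id))
  have : Nonempty V := ⟨x₀⟩
  choose! u v w hTeq hTri hadj using
    fun T hT => h.exists_isTriple_not_adj htri hind hL (T := T) hT
  set L := R \ 𝒯.biUnion id with hLdef
  -- With at least two neighbours of `u T` in `L`, one can be used to form a triple with `u T` and
  -- `w T`, freeing `v T`; otherwise `#L ≥ 3` leaves two non-neighbours to complete `u T, v T`,
  -- freeing `w T`. The threshold 2 allows distinct choices for two triples.
  let f : Finset V → V := fun T => if 2 ≤ #(L.filter (K.Adj (u T))) then v T else w T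
  have hnadj : ∀ T ∈ 𝒯, ∀ a ∈ L, ¬K.Adj a (f T) := by
    intro T hT a ha
    simp only [f]
    split_ifs
    exacts [(hadj T hT a ha).1, (hadj T hT a ha).2]
  have hfmem : ∀ T ∈ 𝒯, f T ∈ T := by
    intro T hT
    have key : ∀ x ∈ ({u T, v T, w T} : Finset V), x ∈ T := fun x hx => by
      rwa [← hTeq T hT] at hx
    simp only [f]
    split_ifs
    exacts [key _ (by simp), key _ (by simp)]
  have hcompl : ∀ T, ¬2 ≤ #(L.filter (K.Adj (u T))) → 2 ≤ #(L.filter fun a => ¬K.Adj (u T) a) := by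
    intro T hT
    have := card_filter_add_card_filter_not (s := L) (K.Adj (u T))
    omega
  have hmixed : ∀ T ∈ 𝒯, ∀ S ∈ 𝒯, T ≠ S → 2 ≤ #(L.filter (K.Adj (u T))) →
      ¬2 ≤ #(L.filter (K.Adj (u S))) → ¬K.Adj (v T) (w S) := by
    intro T hT S hS hTS h1 h2 hvw
    obtain ⟨a, ha, c, hc, b, hb, hau, hcx, hn⟩ := exists_three_of_card_filter hL _
      (fun a => ¬K.Adj (u S) a) h1 (by have := hcompl S h2; omega)
    have hne : ({u T, v T, w T} : Finset V) ≠ {u S, v S, w S} := by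
      rwa [← hTeq T hT, ← hTeq S hS]
    have hf := IsTriple.injective_nine h.1 (hTri T hT) (hTri S hS) hne ha hc hb hn
    exact h.false_of_three (hTri T hT).mem (hTri S hS).mem _ hf (IsTriple.mem_nine ha hc hb)
      ![0, 3, 5, 8, 4, 2, 6, 7, 1] (by decide)
      (Or.inl ⟨hau.symm, (hadj T hT a ha).2, (hTri T hT).left⟩)
      (Or.inl ⟨hvw.symm, fun h' => (hadj S hS b hb).2 h'.symm,
        fun h' => (hadj T hT b hb).1 h'.symm⟩)
      (Or.inl ⟨(hTri S hS).adj, hcx, fun h' => (hadj S hS c hc).1 h'.symm⟩)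
  have hff : ∀ T ∈ 𝒯, ∀ S ∈ 𝒯, T ≠ S → ¬K.Adj (f T) (f S) := by
    intro T hT S hS hTS
    have hne : ({u T, v T, w T} : Finset V) ≠ {u S, v S, w S} := by
      rwa [← hTeq T hT, ← hTeq S hS]
    simp only [f]
    split_ifs with h1 h2 h2
    · intro hvv
      obtain ⟨a, ha, b, hb, c, hc, hau, hbx, hn⟩ := exists_three_of_card_filter hL _ _ h1
        (by omega : 1 ≤ #(L.filter (K.Adj (u S))))
      have hf := IsTriple.injective_nine h.1 (hTri T hT) (hTri S hS) hne ha hb hc hn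
      exact h.false_of_three (hTri T hT).mem (hTri S hS).mem _ hf (IsTriple.mem_nine ha hb hc)
        ![0, 3, 5, 1, 6, 8, 4, 7, 2] (by decide)
        (Or.inl ⟨hau.symm, (hadj T hT a ha).2, (hTri T hT).left⟩)
        (Or.inl ⟨hbx.symm, (hadj S hS b hb).2, (hTri S hS).left⟩)
        (Or.inl ⟨hvv, fun h' => (hadj T hT c hc).1 h'.symm, fun h' => (hadj S hS c hc).1 h'.symm⟩)
    · exact hmixed T hT S hS hTS h1 h2
    · exact fun h' => hmixed S hS T hT hTS.symm h2 h1 h'.symm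
    · intro hww
      obtain ⟨b, hb, c, hc, a, ha, hbu, hcx, hn⟩ := exists_three_of_card_filter hL _ _
        (hcompl T h1) (by have := hcompl S h2; omega : 1 ≤ #(L.filter fun a => ¬K.Adj (u S) a))
      have hf := IsTriple.injective_nine h.1 (hTri T hT) (hTri S hS) hne hb hc ha hn
      exact h.false_of_three (hTri T hT).mem (hTri S hS).mem _ hf (IsTriple.mem_nine hb hc ha)
        ![5, 8, 2, 3, 4, 0, 6, 7, 1] (by decide)
        (Or.inl ⟨hww, fun h' => (hadj T hT a ha).2 h'.symm, fun h' => (hadj S hS a ha).2 h'.symm⟩)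
        (Or.inl ⟨(hTri T hT).adj, hbu, fun h' => (hadj T hT b hb).1 h'.symm⟩)
        (Or.inl ⟨(hTri S hS).adj, hcx, fun h' => (hadj S hS c hc).1 h'.symm⟩)
  have hI := hα (L ∪ 𝒯.image f) (by
    intro x hx y hy
    rcases mem_union.1 hx with hx | hx <;> rcases mem_union.1 hy with hy | hy
    · exact hind _ h _ hx _ hy
    · obtain ⟨T, hT, rfl⟩ := mem_image.1 hy
      exact hnadj T hT x hx
    · obtain ⟨T, hT, rfl⟩ := mem_image.1 hx
      exact fun h' => hnadj T hT y hy h'.symm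
    · obtain ⟨T, hT, rfl⟩ := mem_image.1 hx
      obtain ⟨S, hS, rfl⟩ := mem_image.1 hy
      rcases eq_or_ne T S with rfl | hTS
      · exact K.loopless.irrefl _
      · exact hff T hT S hS hTS)
  -- The independent set has `#L + #𝒯 = 3k - 2#𝒯 > k` vertices.
  rw [card_union_of_disjoint, card_image_of_injOn] at hI
  · omega
  · intro T hT S hS hTS
    by_contra hne
    exact Finset.disjoint_left.1 (h.1.disj T hT S hS hne) (hfmem T hT) (hTS ▸ hfmem S hS)
  · rw [Finset.disjoint_left]
    intro x hx hx'
    obtain ⟨T, hT, rfl⟩ := mem_image.1 hx'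
    exact (mem_sdiff.1 hx).2 (mem_biUnion.2 ⟨T, hT, hfmem T hT⟩)

/-- A set of `3k` vertices of a triangle-free graph without independent sets of more than `k`
vertices can be partitioned into triples spanning exactly one edge each. -/
theorem exists_isPacking_card_eq (htri : ∀ x y z, K.Adj x y → K.Adj x z → ¬K.Adj y z) {k : ℕ}
    (hα : ∀ I : Finset V, (∀ x ∈ I, ∀ y ∈ I, ¬K.Adj x y) → #I ≤ k) (hR : #R = 3 * k)
    (hk : 4 ≤ k) : ∃ 𝒯, K.IsPacking R 𝒯 ∧ #𝒯 = k := by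
  obtain ⟨𝒯, h⟩ := exists_isMaxPacking K R
  exact ⟨𝒯, h.1, h.card_eq htri hα hR hk⟩

end SimpleGraph

/-! ### Averages over random permutations -/

section RandomPermutation

lemma Equiv.Perm.exists_trans_eq {α : Type*} {m : ℕ} (e e' : Fin m ↪ α) :
    ∃ τ : Equiv.Perm α, e.trans τ.toEmbedding = e' := by
  obtain ⟨τ, hτ⟩ := (MulAction.isMultiplyPretransitive_iff (G := Equiv.Perm α) (α := α)).1
    (Equiv.Perm.isMultiplyPretransitive α m) e e'
  refine ⟨τ, ?_⟩
  rw [← hτ]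
  ext i
  rfl

variable {α : Type*} [Fintype α] [DecidableEq α]

/-- The symmetric group is transitive on injective `m`-tuples, so the sum over `σ` does not depend
on `e`; double counting over `e` and `σ` then shows that a random image of `e` is uniform. -/
lemma Equiv.Perm.descFactorial_mul_sum {m : ℕ} (e : Fin m ↪ α) (F : (Fin m ↪ α) → ℝ) :
    ((Fintype.card α).descFactorial m : ℝ) * ∑ σ : Equiv.Perm α, F (e.trans σ.toEmbedding) =
      (Fintype.card α).factorial * ∑ e', F e' := by
  have h1 : ∀ e' : Fin m ↪ α, ∑ σ : Equiv.Perm α, F (e'.trans σ.toEmbedding) =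
      ∑ σ : Equiv.Perm α, F (e.trans σ.toEmbedding) := by
    intro e'
    obtain ⟨τ, rfl⟩ := exists_trans_eq e e'
    exact Fintype.sum_equiv (Equiv.mulRight τ) _ _ fun σ => rfl
  have h2 : ∀ σ : Equiv.Perm α, ∑ e' : Fin m ↪ α, F (e'.trans σ.toEmbedding) = ∑ e', F e' :=
    fun σ => Fintype.sum_equiv (Equiv.embeddingCongr (Equiv.refl _) σ) _ _ fun e' => rfl
  calc _ = ∑ e' : Fin m ↪ α, ∑ σ : Equiv.Perm α, F (e'.trans σ.toEmbedding) := by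
        rw [sum_congr rfl fun e' _ => h1 e', sum_const, card_univ, Fintype.card_embedding_eq,
          Fintype.card_fin, nsmul_eq_mul]
    _ = _ := by
        rw [sum_comm, sum_congr rfl fun σ _ => h2 σ, sum_const, card_univ, Fintype.card_perm,
          nsmul_eq_mul]

lemma Equiv.Perm.sum_pair {x y : α} (hxy : x ≠ y) (F : α → α → ℝ) (hF : ∀ x, F x x = 0) :
    ((Fintype.card α).descFactorial 2 : ℝ) * ∑ σ : Equiv.Perm α, F (σ x) (σ y) =
      (Fintype.card α).factorial * ∑ x, ∑ y, F x y := by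
  have hinj : Function.Injective ![x, y] := by
    rw [← List.nodup_ofFn]
    simp [hxy]
  have key := Equiv.Perm.descFactorial_mul_sum ⟨![x, y], hinj⟩ fun e => F (e 0) (e 1)
  refine key.trans ?_
  congr 1
  have h1 : Function.Injective fun e : Fin 2 ↪ α => (e 0, e 1) := by
    intro e e' h
    simp only [Prod.mk.injEq] at h
    ext i
    fin_cases i
    exacts [h.1, h.2]
  rw [← Fintype.sum_prod_type' F, ← sum_image (s := univ) (f := fun q : α × α => F q.1 q.2)
    (g := fun e : Fin 2 ↪ α => (e 0, e 1)) h1.injOn]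
  refine sum_subset (subset_univ _) ?_
  rintro ⟨a, b⟩ - h
  by_cases hab : a = b
  · rw [hab]
    exact hF b
  · have hinj' : Function.Injective ![a, b] := by
      rw [← List.nodup_ofFn]
      simp [hab]
    exact absurd (mem_image.2 ⟨(⟨![a, b], hinj'⟩ : Fin 2 ↪ α), mem_univ _, rfl⟩) h

/-- Only an inequality, because the right side also admits quadruples whose two pairs overlap. -/
lemma Equiv.Perm.sum_quadruple_le {x y z w : α} (h : [x, y, z, w].Nodup)
    (F : α → α → α → α → ℝ) (hF : ∀ x y z w, 0 ≤ F x y z w) :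
    ((Fintype.card α).descFactorial 4 : ℝ) *
        ∑ σ : Equiv.Perm α, F (σ x) (σ y) (σ z) (σ w) ≤
      (Fintype.card α).factorial * ∑ x, ∑ y, ∑ z, ∑ w,
        if x ≠ y ∧ z ≠ w then F x y z w else 0 := by
  have hinj : Function.Injective ![x, y, z, w] := by
    rw [← List.nodup_ofFn]
    exact h
  have key := Equiv.Perm.descFactorial_mul_sum ⟨![x, y, z, w], hinj⟩
    fun e => F (e 0) (e 1) (e 2) (e 3)
  refine key.trans_le ?_
  gcongr
  have h1 : Function.Injective fun e : Fin 4 ↪ α => (e 0, e 1, e 2, e 3) := by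
    intro e e' h
    simp only [Prod.mk.injEq] at h
    ext i
    fin_cases i
    exacts [h.1, h.2.1, h.2.2.1, h.2.2.2]
  let Φ : α × α × α × α → ℝ := fun q =>
    if q.1 ≠ q.2.1 ∧ q.2.2.1 ≠ q.2.2.2 then F q.1 q.2.1 q.2.2.1 q.2.2.2 else 0
  have h2 : ∑ x, ∑ y, ∑ z, ∑ w, (if x ≠ y ∧ z ≠ w then F x y z w else 0) = ∑ q, Φ q := by
    simp only [Φ, Fintype.sum_prod_type]
  have h3 : ∀ e : Fin 4 ↪ α, F (e 0) (e 1) (e 2) (e 3) = Φ (e 0, e 1, e 2, e 3) := by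
    intro e
    have h01 : e 0 ≠ e 1 := fun h' => absurd (e.injective h') (by decide)
    have h23 : e 2 ≠ e 3 := fun h' => absurd (e.injective h') (by decide)
    simp [Φ, h01, h23]
  rw [h2, sum_congr rfl fun e _ => h3 e, ← sum_image (f := Φ)
    (g := fun e : Fin 4 ↪ α => (e 0, e 1, e 2, e 3)) h1.injOn]
  refine sum_le_sum_of_subset_of_nonneg (subset_univ _) ?_
  rintro ⟨a, b, c, d⟩ - -
  simp only [Φ]
  split_ifs
  exacts [hF _ _ _ _, le_rfl]

end RandomPermutation

/-! ### Selecting a cheap subfamily by averaging -/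

section Selection

variable {ι : Type*} [DecidableEq ι]

/-- A set of indices has a subset of size `m` in which the linear and quadratic weights scale at
least as well as on average. -/
lemma exists_subset_card_eq_weight_le {m : ℕ} (S : Finset ι) (hm : 0 < m) (hS : m ≤ #S)
    (c : ι → ℝ) (d : ι → ι → ℝ) (hc : ∀ i, 0 ≤ c i) (hd : ∀ i j, 0 ≤ d i j)
    (hdd : ∀ i, d i i = 0) :
    ∃ s ⊆ S, #s = m ∧ ∑ i ∈ s, c i + ∑ i ∈ s, ∑ j ∈ s, d i j ≤
      (m / #S : ℝ) * ∑ i ∈ S, c i + (m / #S : ℝ) ^ 2 * ∑ i ∈ S, ∑ j ∈ S, d i j := by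
  induction hn : #S - m generalizing S c d with
  | zero =>
    have : #S = m := by omega
    refine ⟨S, Subset.rfl, this, ?_⟩
    have hm' : (m : ℝ) ≠ 0 := by positivity
    rw [this, div_self hm']
    simp
  | succ r ih =>
    have hM : m + 1 ≤ #S := by omega
    set M := #S with hMdef
    have hm1 : (1 : ℝ) ≤ m := by exact_mod_cast hm
    have hM1 : (m : ℝ) + 1 ≤ M := by exact_mod_cast hM
    have hMpos : (0 : ℝ) < M := by linarith
    have hMpos' : (0 : ℝ) < M - 1 := by linarith
    set q : ℝ := m / (M - 1) with hq
    have hq0 : 0 ≤ q := by positivity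
    set C := ∑ i ∈ S, c i with hC
    set D := ∑ i ∈ S, ∑ j ∈ S, d i j with hD
    have hD0 : 0 ≤ D := sum_nonneg fun i _ => sum_nonneg fun j _ => hd i j
    have hdel : ∀ x ∈ S, ∑ i ∈ S.erase x, ∑ j ∈ S.erase x, d i j =
        D - ∑ j ∈ S, d x j - ∑ j ∈ S, d j x := by
      intro x hx
      have h1 : ∀ i, ∑ j ∈ S.erase x, d i j = ∑ j ∈ S, d i j - d i x := fun i => by
        rw [← add_sum_erase S _ hx]; ring
      rw [sum_congr rfl fun i _ => h1 i, sum_sub_distrib]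
      have h2 := add_sum_erase S (fun i => ∑ j ∈ S, d i j) hx
      have h3 := add_sum_erase S (fun i => d i x) hx
      simp only [hdd x] at h3
      linarith
    have hdelc : ∀ x ∈ S, ∑ i ∈ S.erase x, c i = C - c x := by
      intro x hx
      rw [hC, ← add_sum_erase S _ hx]
      ring
    -- Delete an average index. The diagonal vanishes, so each quadratic term survives `M - 2` of
    -- the `M` deletions.
    have havg : ∃ x ∈ S, q * (C - c x) + q ^ 2 * (D - ∑ j ∈ S, d x j - ∑ j ∈ S, d j x) ≤
        (q * ((M - 1) * C) + q ^ 2 * ((M - 2) * D)) / M := by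
      refine exists_le_of_sum_le (card_pos.1 (by omega)) ?_
      rw [sum_const, nsmul_eq_mul, ← hMdef, mul_div_cancel₀ _ hMpos.ne', sum_add_distrib,
        ← mul_sum, ← mul_sum, sum_sub_distrib, sum_sub_distrib, sum_sub_distrib,
        sum_comm (f := fun x j => d j x), sum_const, sum_const, nsmul_eq_mul, nsmul_eq_mul,
        ← hMdef, ← hC, ← hD]
      apply le_of_eq
      ring
    obtain ⟨x, hx, hxle⟩ := havg
    have hcard : #(S.erase x) = M - 1 := card_erase_of_mem hx
    obtain ⟨s, hs, hsm, hle⟩ := ih (S.erase x) (by omega) c d hc hd hdd (by omega)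
    refine ⟨s, hs.trans (erase_subset _ _), hsm, hle.trans ?_⟩
    have hcast : ((M - 1 : ℕ) : ℝ) = M - 1 := by
      rw [Nat.cast_sub (by omega)]
      simp
    rw [hcard, hcast, ← hq, hdelc x hx, hdel x hx]
    refine hxle.trans ?_
    have e1 : q * ((M - 1) * C) = m * C := by
      rw [hq]; field_simp
    -- This is `M(M - 2) ≤ (M - 1)²`.
    have e2 : q ^ 2 * ((M - 2) * D) ≤ m ^ 2 / M * D := by
      rw [← mul_assoc]
      refine mul_le_mul_of_nonneg_right ?_ hD0
      rw [hq, div_pow, div_mul_eq_mul_div, div_le_div_iff₀ (by positivity) hMpos]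
      have : (0 : ℝ) ≤ m ^ 2 := by positivity
      nlinarith
    rw [div_le_iff₀ hMpos]
    have e3 : ((m / M : ℝ) * C + (m / M) ^ 2 * D) * M = m * C + m ^ 2 / M * D := by
      field_simp
    rw [e3, e1]
    linarith

lemma exists_subset_weight_le_of_div_le [Fintype ι] {m : ℕ} (S : Finset ι) (hm : 0 < m)
    (hS : m ≤ #S) {p : ℝ} (hp : (m / #S : ℝ) ≤ p) (c : ι → ℝ) (d : ι → ι → ℝ) (hc : ∀ i, 0 ≤ c i)
    (hd : ∀ i j, 0 ≤ d i j) (hdd : ∀ i, d i i = 0) :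
    ∃ s ⊆ S, #s = m ∧ ∑ i ∈ s, c i + ∑ i ∈ s, ∑ j ∈ s, d i j ≤
      ∑ i, p * c i + ∑ i, ∑ j, p ^ 2 * d i j := by
  obtain ⟨s, hs, hsm, hle⟩ := exists_subset_card_eq_weight_le S hm hS c d hc hd hdd
  refine ⟨s, hs, hsm, hle.trans ?_⟩
  simp only [← mul_sum]
  have hq : (0 : ℝ) ≤ m / #S := by positivity
  have hp0 : 0 ≤ p := hq.trans hp
  have h1 : ∑ i ∈ S, c i ≤ ∑ i, c i :=
    sum_le_sum_of_subset_of_nonneg (subset_univ _) fun _ _ _ => hc _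
  have h2 : ∑ i ∈ S, ∑ j ∈ S, d i j ≤ ∑ i, ∑ j, d i j :=
    (sum_le_sum fun i _ => sum_le_sum_of_subset_of_nonneg (subset_univ _) fun _ _ _ => hd _ _).trans
    (sum_le_sum_of_subset_of_nonneg (subset_univ _) fun _ _ _ => sum_nonneg fun _ _ => hd _ _)
  have h3 : 0 ≤ ∑ i ∈ S, c i := sum_nonneg fun _ _ => hc _
  have h4 : 0 ≤ ∑ i ∈ S, ∑ j ∈ S, d i j := sum_nonneg fun _ _ => sum_nonneg fun _ _ => hd _ _
  gcongr

end Selection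

/-! ### Moments of a random matching -/

section RandomMatching

lemma two_mul_le_card_of_embedding {α : Type*} [Fintype α] {h : ℕ} (e : Fin h × Fin 2 ↪ α) :
    2 * h ≤ Fintype.card α := by
  have := Fintype.card_le_of_embedding e
  simp at this
  omega

lemma nodup_of_embedding {α : Type*} {h : ℕ} (e : Fin h × Fin 2 ↪ α) {i j : Fin h} (hij : i ≠ j) :
    [e (i, 0), e (i, 1), e (j, 0), e (j, 1)].Nodup := by
  simp [hij]

lemma descFactorial_two_cast {N : ℕ} (hN : 2 ≤ N) :
    (N.descFactorial 2 : ℝ) = N * (N - 1) := by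
  obtain ⟨N, rfl⟩ := Nat.exists_eq_add_of_le hN
  simp [Nat.descFactorial]
  ring_nf

lemma descFactorial_four_cast {N : ℕ} (hN : 4 ≤ N) :
    (N.descFactorial 4 : ℝ) = N * (N - 1) * (N - 2) * (N - 3) := by
  obtain ⟨N, rfl⟩ := Nat.exists_eq_add_of_le' hN
  have h1 : N + 4 - 3 = N + 1 := by omega
  have h2 : N + 4 - 2 = N + 2 := by omega
  have h3 : N + 4 - 1 = N + 3 := by omega
  simp only [Nat.descFactorial, h1, h2, h3, Nat.sub_zero, mul_one]
  push_cast
  ring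

variable {α : Type*} [Fintype α] [DecidableEq α] {h : ℕ} (e : Fin h × Fin 2 ↪ α)

/-- The total weight of the pairs of a random matching. -/
lemma sum_perm_linear (hN : 4 ≤ Fintype.card α) (c : α → α → ℝ) (hc : ∀ x, c x x = 0) :
    ∑ σ : Equiv.Perm α, ∑ i, c (σ (e (i, 0))) (σ (e (i, 1))) =
      (Fintype.card α).factorial * (h * (∑ x, ∑ y, c x y) /
        (Fintype.card α * (Fintype.card α - 1))) := by
  have hN' : (4 : ℝ) ≤ Fintype.card α := by exact_mod_cast hN
  have key : ∀ i, ∑ σ : Equiv.Perm α, c (σ (e (i, 0))) (σ (e (i, 1))) =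
      (Fintype.card α).factorial * (∑ x, ∑ y, c x y) /
        (Fintype.card α * (Fintype.card α - 1)) := by
    intro i
    have := Equiv.Perm.sum_pair (x := e (i, 0)) (y := e (i, 1)) (by simp) c hc
    rw [descFactorial_two_cast (by omega)] at this
    rw [← this, mul_div_cancel_left₀]
    have : (0 : ℝ) < Fintype.card α - 1 := by linarith
    positivity
  rw [sum_comm, sum_congr rfl fun i _ => key i, sum_const, card_univ, Fintype.card_fin,
    nsmul_eq_mul]
  ring

/-- The total weight of the pairs of edges of a random matching. -/
lemma sum_perm_quadratic_le (hN : 4 ≤ Fintype.card α) (d : α → α → α → α → ℝ)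
    (hd : ∀ x y z w, 0 ≤ d x y z w) :
    ∑ σ : Equiv.Perm α, ∑ i, ∑ j, (if i = j then 0 else
      d (σ (e (i, 0))) (σ (e (i, 1))) (σ (e (j, 0))) (σ (e (j, 1)))) ≤
      (Fintype.card α).factorial * (h * (h - 1) *
        (∑ x, ∑ y, ∑ z, ∑ w, if x ≠ y ∧ z ≠ w then d x y z w else 0) /
        (Fintype.card α * (Fintype.card α - 1) * (Fintype.card α - 2) *
          (Fintype.card α - 3))) := by
  have hN' : (4 : ℝ) ≤ Fintype.card α := by exact_mod_cast hN
  set D := ∑ x, ∑ y, ∑ z, ∑ w, if x ≠ y ∧ z ≠ w then d x y z w else 0 with hD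
  set Q : ℝ := Fintype.card α * (Fintype.card α - 1) * (Fintype.card α - 2) *
    (Fintype.card α - 3) with hQ
  have hQ0 : 0 < Q := by
    have h1 : (0 : ℝ) < Fintype.card α - 1 := by linarith
    have h2 : (0 : ℝ) < Fintype.card α - 2 := by linarith
    have h3 : (0 : ℝ) < Fintype.card α - 3 := by linarith
    positivity
  have key : ∀ i j, ∑ σ : Equiv.Perm α, (if i = j then 0 else
      d (σ (e (i, 0))) (σ (e (i, 1))) (σ (e (j, 0))) (σ (e (j, 1)))) ≤
      if i = j then 0 else (Fintype.card α).factorial * D / Q := by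
    intro i j
    split_ifs with hij
    · simp
    · have := Equiv.Perm.sum_quadruple_le (nodup_of_embedding e hij) d hd
      rw [descFactorial_four_cast hN, ← hQ, ← hD] at this
      rw [le_div_iff₀ hQ0, mul_comm]
      exact this
  calc _ = ∑ i, ∑ j, ∑ σ : Equiv.Perm α, (if i = j then 0 else
      d (σ (e (i, 0))) (σ (e (i, 1))) (σ (e (j, 0))) (σ (e (j, 1)))) := by
        rw [sum_comm]
        exact sum_congr rfl fun i _ => sum_comm
    _ ≤ ∑ i : Fin h, ∑ j : Fin h, if i = j then 0 else (Fintype.card α).factorial * D / Q :=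
        sum_le_sum fun i _ => sum_le_sum fun j _ => key i j
    _ = ∑ i : Fin h, ((h - 1 : ℝ) * ((Fintype.card α).factorial * D / Q)) := by
        refine sum_congr rfl fun i _ => ?_
        rw [sum_ite, sum_const_zero, zero_add, sum_const, nsmul_eq_mul]
        congr 1
        have h1 : (univ.filter fun j => ¬i = j) = univ.erase i := by
          ext; simp [eq_comm]
        have h2 : 1 ≤ h := i.pos
        rw [h1, card_erase_of_mem (mem_univ _), card_univ, Fintype.card_fin, Nat.cast_sub h2]
        simp
    _ = _ := by
        rw [sum_const, card_univ, Fintype.card_fin, nsmul_eq_mul]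
        ring

/-- The number of pairs of a random matching that belong to a given sparse graph has variance at
most the number of vertices. -/
lemma sum_perm_sq_sub_le (hN : 7 ≤ Fintype.card α) (a : α → α → ℝ)
    (ha : ∀ x y, a x y = 0 ∨ a x y = 1) (haa : ∀ x, a x x = 0)
    (hS : ∑ x, ∑ y, a x y ≤ Fintype.card α * (Fintype.card α - 1) / 2) :
    ∑ σ : Equiv.Perm α, (∑ i, a (σ (e (i, 0))) (σ (e (i, 1))) -
      h * (∑ x, ∑ y, a x y) / (Fintype.card α * (Fintype.card α - 1))) ^ 2 ≤
      ((Fintype.card α).factorial * Fintype.card α : ℝ) := by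
  have hN' : (7 : ℝ) ≤ Fintype.card α := by exact_mod_cast hN
  have hh : 2 * (h : ℝ) ≤ Fintype.card α := by exact_mod_cast two_mul_le_card_of_embedding e
  have ha0 : ∀ x y, 0 ≤ a x y := fun x y => by rcases ha x y with h' | h' <;> simp [h']
  have ha2 : ∀ x y, a x y * a x y = a x y := fun x y => by rcases ha x y with h' | h' <;> simp [h']
  set N : ℝ := (Fintype.card α : ℝ) with hNdef
  set S := ∑ x, ∑ y, a x y with hSdef
  have hS0 : 0 ≤ S := sum_nonneg fun x _ => sum_nonneg fun y _ => ha0 x y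
  set μ := h * S / (N * (N - 1)) with hμ
  let X : Equiv.Perm α → ℝ := fun σ => ∑ i, a (σ (e (i, 0))) (σ (e (i, 1)))
  have h1 : ∑ σ, X σ = (Fintype.card α).factorial * μ := sum_perm_linear e (by omega) a haa
  have h2 : ∑ σ, X σ ^ 2 ≤ (Fintype.card α).factorial * μ + (Fintype.card α).factorial *
      (h * (h - 1) * S ^ 2 / (N * (N - 1) * (N - 2) * (N - 3))) := by
    -- The diagonal of the square is `X` itself, since `a` takes values 0 and 1.
    have hsq : ∀ σ, X σ ^ 2 = X σ + ∑ i, ∑ j, (if i = j then 0 else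
        a (σ (e (i, 0))) (σ (e (i, 1))) * a (σ (e (j, 0))) (σ (e (j, 1)))) := by
      intro σ
      rw [sq, sum_mul_sum, ← sum_add_distrib]
      refine sum_congr rfl fun i _ => ?_
      rw [← add_sum_erase univ _ (mem_univ i), ha2,
        ← add_sum_erase univ (fun j => if i = j then _ else _) (mem_univ i), if_pos rfl, zero_add]
      congr 1
      exact sum_congr rfl fun j hj => by rw [if_neg (ne_of_mem_erase hj).symm]
    rw [sum_congr rfl fun σ _ => hsq σ, sum_add_distrib, h1]
    gcongr
    refine (sum_perm_quadratic_le e (by omega) (fun x y z w => a x y * a z w)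
      fun x y z w => mul_nonneg (ha0 _ _) (ha0 _ _)).trans ?_
    have hpos1 : (0 : ℝ) ≤ N - 1 := by linarith
    have hpos2 : (0 : ℝ) ≤ N - 2 := by linarith
    have hpos3 : (0 : ℝ) ≤ N - 3 := by linarith
    have hposh : (0 : ℝ) ≤ h * (h - 1) := by
      rcases Nat.eq_zero_or_pos h with h0 | h0
      · simp [h0]
      · have : (1 : ℝ) ≤ h := by exact_mod_cast h0
        exact mul_nonneg (by positivity) (by linarith)
    have hD : (∑ x, ∑ y, ∑ z, ∑ w, if x ≠ y ∧ z ≠ w then a x y * a z w else 0) ≤ S ^ 2 := by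
      have : S ^ 2 = ∑ x, ∑ y, ∑ z, ∑ w, a x y * a z w := by
        rw [sq, hSdef, sum_mul]
        refine sum_congr rfl fun x _ => ?_
        rw [sum_mul]
        refine sum_congr rfl fun y _ => ?_
        rw [mul_sum]
        exact sum_congr rfl fun z _ => mul_sum _ _ _
      rw [this]
      refine sum_le_sum fun x _ => sum_le_sum fun y _ => sum_le_sum fun z _ =>
        sum_le_sum fun w _ => ?_
      split_ifs
      exacts [le_rfl, mul_nonneg (ha0 _ _) (ha0 _ _)]
    gcongr
  have h3 : ∑ σ, (X σ - μ) ^ 2 = ∑ σ, X σ ^ 2 - 2 * μ * ∑ σ, X σ +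
      (Fintype.card α).factorial * μ ^ 2 := by
    rw [mul_sum, ← sum_sub_distrib, ← Fintype.card_perm, ← card_univ, ← nsmul_eq_mul,
      ← sum_const, ← sum_add_distrib]
    exact sum_congr rfl fun σ _ => by ring
  change ∑ σ, (X σ - μ) ^ 2 ≤ _
  have h4 : μ + h * (h - 1) * S ^ 2 / (N * (N - 1) * (N - 2) * (N - 3)) - μ ^ 2 ≤ N := by
    have hp1 : 0 < N - 1 := by linarith
    have hp2 : 0 < N - 2 := by linarith
    have hp3 : 0 < N - 3 := by linarith
    have hp0 : 0 < N := by linarith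
    set t := S / (N * (N - 1)) with ht
    have ht0 : 0 ≤ t := by positivity
    have ht1 : t ≤ 1 / 2 := by
      rw [ht, div_le_div_iff₀ (by positivity) (by norm_num)]
      linarith
    have hμt : μ = h * t := by rw [hμ, ht, mul_div_assoc]
    have hSt : S = t * (N * (N - 1)) := by rw [ht]; field_simp
    have hh0 : (0 : ℝ) ≤ h := by positivity
    -- This amounts to `4N² - 34N + 48 ≥ 0`, true for `N ≥ 7` but false at 6. With the mean at most
    -- `N/4`, the correction term adds at most `N/2` to the variance.
    have hr : N * (N - 1) / ((N - 2) * (N - 3)) ≤ 1 + 8 / N := by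
      rw [div_le_iff₀ (by positivity)]
      have : (1 + 8 / N) * ((N - 2) * (N - 3)) - N * (N - 1) = (4 * N ^ 2 - 34 * N + 48) / N := by
        field_simp; ring
      have h5 : 0 ≤ (4 * N ^ 2 - 34 * N + 48) / N := div_nonneg (by nlinarith) hp0.le
      linarith
    have hq : h * (h - 1) * S ^ 2 / (N * (N - 1) * (N - 2) * (N - 3)) ≤
        h ^ 2 * t ^ 2 * (1 + 8 / N) := by
      have : h * (h - 1) * S ^ 2 / (N * (N - 1) * (N - 2) * (N - 3)) =
          (h * (h - 1)) * t ^ 2 * (N * (N - 1) / ((N - 2) * (N - 3))) := by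
        rw [hSt]; field_simp
      rw [this]
      refine mul_le_mul ?_ hr (by positivity) (by positivity)
      exact mul_le_mul_of_nonneg_right (by nlinarith) (by positivity)
    have hht : h * t ≤ N / 4 := by nlinarith
    have hht2 : (h * t) ^ 2 ≤ (N / 4) ^ 2 := pow_le_pow_left₀ (by positivity) hht 2
    have h6 : (h * t) ^ 2 * (8 / N) ≤ N / 2 := by
      rw [mul_div_assoc', div_le_iff₀ hp0]
      nlinarith
    rw [hμt]
    have : (h : ℝ) ^ 2 * t ^ 2 * (1 + 8 / N) = (h * t) ^ 2 + (h * t) ^ 2 * (8 / N) := by ring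
    linarith
  have hfac : (0 : ℝ) ≤ (Fintype.card α).factorial := by positivity
  rw [h3, h1]
  nlinarith [mul_le_mul_of_nonneg_left h4 hfac]

/-- A random matching that is typical for the sparse graph `a` and cheap on average for the linear
and quadratic weights `c` and `d`. -/
lemma exists_perm_weight_le (hN : 7 ≤ Fintype.card α) (a : α → α → ℝ)
    (ha : ∀ x y, a x y = 0 ∨ a x y = 1) (haa : ∀ x, a x x = 0)
    (hS : ∑ x, ∑ y, a x y ≤ Fintype.card α * (Fintype.card α - 1) / 2)
    (c : α → α → ℝ) (hc : ∀ x y, 0 ≤ c x y) (hcc : ∀ x, c x x = 0) (d : α → α → α → α → ℝ)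
    (hd : ∀ x y z w, 0 ≤ d x y z w) {t : ℝ} (ht : 0 < t) (hNt : Fintype.card α < t ^ 2) :
    ∃ σ : Equiv.Perm α,
      ∑ i, a (σ (e (i, 0))) (σ (e (i, 1))) ≤
        h * (∑ x, ∑ y, a x y) / (Fintype.card α * (Fintype.card α - 1)) + t ∧
      ∑ i, c (σ (e (i, 0))) (σ (e (i, 1))) + ∑ i, ∑ j, (if i = j then 0 else
        d (σ (e (i, 0))) (σ (e (i, 1))) (σ (e (j, 0))) (σ (e (j, 1)))) ≤
      1 / (1 - Fintype.card α / t ^ 2) *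
        (h * (∑ x, ∑ y, c x y) / (Fintype.card α * (Fintype.card α - 1)) + h * (h - 1) *
        (∑ x, ∑ y, ∑ z, ∑ w, if x ≠ y ∧ z ≠ w then d x y z w else 0) /
        (Fintype.card α * (Fintype.card α - 1) * (Fintype.card α - 2) *
          (Fintype.card α - 3))) := by
  have hvar := sum_perm_sq_sub_le e hN a ha haa hS
  have hlin := sum_perm_linear e (by omega) c hcc
  have hquad := sum_perm_quadratic_le e (by omega) d hd
  set μ := h * (∑ x, ∑ y, a x y) / (Fintype.card α * (Fintype.card α - 1) : ℝ)
  set B₁ := h * (∑ x, ∑ y, c x y) / (Fintype.card α * (Fintype.card α - 1) : ℝ)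
  set B₂ := h * (h - 1) * (∑ x, ∑ y, ∑ z, ∑ w, if x ≠ y ∧ z ≠ w then d x y z w else 0) /
        (Fintype.card α * (Fintype.card α - 1) * (Fintype.card α - 2) *
          (Fintype.card α - 3) : ℝ)
  let X : Equiv.Perm α → ℝ := fun σ => ∑ i, a (σ (e (i, 0))) (σ (e (i, 1)))
  let T : Equiv.Perm α → ℝ := fun σ => ∑ i, c (σ (e (i, 0))) (σ (e (i, 1))) +
    ∑ i, ∑ j, (if i = j then 0 else
        d (σ (e (i, 0))) (σ (e (i, 1))) (σ (e (j, 0))) (σ (e (j, 1))))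
  have hT0 : ∀ σ, 0 ≤ T σ := by
    intro σ
    refine add_nonneg (sum_nonneg fun i _ => hc _ _) (sum_nonneg fun i _ => sum_nonneg fun j _ => ?_)
    split_ifs
    exacts [le_rfl, hd _ _ _ _]
  have hTsum : ∑ σ, T σ ≤ (Fintype.card α).factorial * (B₁ + B₂) := by
    rw [sum_add_distrib, hlin, mul_add]
    gcongr
  have hfac : (0 : ℝ) < (Fintype.card α).factorial := by positivity
  have ht2 : 0 < t ^ 2 := by positivity
  set 𝒢 := univ.filter fun σ : Equiv.Perm α => X σ ≤ μ + t with h𝒢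
  -- Chebyshev's inequality for the upper tail.
  have hcompl : (#(univ.filter fun σ : Equiv.Perm α => ¬X σ ≤ μ + t) : ℝ) * t ^ 2 ≤
      (Fintype.card α).factorial * Fintype.card α := by
    refine le_trans ?_ hvar
    rw [← nsmul_eq_mul]
    refine (card_nsmul_le_sum _ (fun σ => (X σ - μ) ^ 2) _ fun σ hσ => ?_).trans
      (sum_le_sum_of_subset_of_nonneg (filter_subset _ _) fun _ _ _ => sq_nonneg _)
    have := (mem_filter.1 hσ).2
    push Not at this
    exact pow_le_pow_left₀ ht.le (by linarith) 2
  have hcard : (#𝒢 : ℝ) + #(univ.filter fun σ : Equiv.Perm α => ¬X σ ≤ μ + t) =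
      (Fintype.card α).factorial := by
    rw [← Fintype.card_perm, ← card_univ]
    exact_mod_cast card_filter_add_card_filter_not _
  set q : ℝ := 1 - Fintype.card α / t ^ 2 with hq
  have hq0 : 0 < q := by
    rw [hq, sub_pos, div_lt_one ht2]
    exact hNt
  have h𝒢q : (Fintype.card α).factorial * q ≤ (#𝒢 : ℝ) := by
    have : (#(univ.filter fun σ : Equiv.Perm α => ¬X σ ≤ μ + t) : ℝ) ≤
      (Fintype.card α).factorial * (Fintype.card α / t ^ 2) := by
      rw [mul_div_assoc', le_div_iff₀ ht2]
      exact hcompl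
    rw [hq, mul_sub, mul_one]
    linarith
  have h𝒢0 : (0 : ℝ) < #𝒢 := lt_of_lt_of_le (by positivity) h𝒢q
  have hB : 0 ≤ B₁ + B₂ := by
    have : 0 ≤ ∑ σ, T σ := sum_nonneg fun σ _ => hT0 σ
    by_contra hneg
    push Not at hneg
    nlinarith
  -- As `T ≥ 0`, its average over the typical permutations is at most the full average divided by
  -- their proportion.
  obtain ⟨σ, hσ, hle⟩ : ∃ σ ∈ 𝒢, T σ ≤ 1 / q * (B₁ + B₂) := by
    refine exists_le_of_sum_le (card_pos.1 (by exact_mod_cast h𝒢0)) ?_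
    rw [sum_const, nsmul_eq_mul]
    calc ∑ σ ∈ 𝒢, T σ ≤ ∑ σ, T σ :=
          sum_le_sum_of_subset_of_nonneg (subset_univ _) fun σ _ _ => hT0 σ
      _ ≤ (Fintype.card α).factorial * (B₁ + B₂) := hTsum
      _ = ((Fintype.card α).factorial * q) * (1 / q * (B₁ + B₂)) := by field_simp
      _ ≤ _ := mul_le_mul_of_nonneg_right h𝒢q (by positivity)
  exact ⟨σ, (mem_filter.1 hσ).2, hle⟩

end RandomMatching

/-! ### Minors from branch sets -/

namespace SimpleGraph

variable {V : Type*}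

lemma sum_adj_eq_two_mul_ncard [Fintype V] (K : SimpleGraph V) [DecidableRel K.Adj] :
    ∑ x, ∑ y, (if K.Adj x y then (1 : ℝ) else 0) = 2 * K.edgeSet.ncard := by
  classical
  have h1 : ∀ x, ∑ y, (if K.Adj x y then (1 : ℝ) else 0) = (K.degree x : ℝ) := by
    intro x
    rw [sum_boole, ← card_neighborFinset_eq_degree, neighborFinset_eq_filter]
  rw [sum_congr rfl fun x _ => h1 x, ← Nat.cast_sum, sum_degrees_eq_twice_card_edges,
    Set.ncard_eq_toFinset_card', edgeFinset]
  simp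

/-- Disjoint connected sets indexed by `n` elements form the branch sets of a minor whose
non-edges are the pairs of sets without an edge between them. -/
lemma exists_isMinorOf (G : SimpleGraph V) {I : Type*} [Fintype I] [DecidableEq I] {n : ℕ}
    (hI : Fintype.card I = n) (B : I → Set V) (hB : ∀ i, (G.induce (B i)).Connected)
    (hd : ∀ i j, i ≠ j → Disjoint (B i) (B j)) (f : I → I → ℝ)
    (hf : ∀ i j, 0 ≤ f i j)
    (hf1 : ∀ i j, i ≠ j → (∀ x ∈ B i, ∀ y ∈ B j, ¬G.Adj x y) → 1 ≤ f i j) :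
    ∃ H : SimpleGraph (Fin n), H.IsMinorOf G ∧
      (n.choose 2 : ℝ) - (H.edgeSet.ncard : ℝ) ≤ (∑ i, ∑ j, f i j) / 2 := by
  classical
  let φ : Fin n ≃ I := (Fintype.equivFinOfCardEq hI).symm
  let H : SimpleGraph (Fin n) :=
    { Adj := fun i j => i ≠ j ∧ ∃ x ∈ B (φ i), ∃ y ∈ B (φ j), G.Adj x y
      symm := ⟨fun i j ⟨h, x, hx, y, hy, hxy⟩ => ⟨h.symm, y, hy, x, hx, hxy.symm⟩⟩
      loopless := ⟨fun i h => h.1 rfl⟩ }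
  refine ⟨H, ⟨fun i => B (φ i), fun i => hB _, fun i j hij => hd _ _ (φ.injective.ne hij),
    fun i j hij => hij.2⟩, ?_⟩
  have h1 := sum_adj_eq_two_mul_ncard H
  have h2 : ∀ i j, 1 - (if i = j then (1 : ℝ) else 0) - (if H.Adj i j then (1 : ℝ) else 0) ≤
      f (φ i) (φ j) := by
    intro i j
    by_cases hij : i = j
    · subst hij
      simpa using hf _ _
    · by_cases ha : H.Adj i j
      · simpa [hij, ha] using hf _ _
      · have := hf1 (φ i) (φ j) (φ.injective.ne hij) fun x hx y hy hxy =>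
          ha ⟨hij, x, hx, y, hy, hxy⟩
        simpa [hij, ha] using this
  have h3 : ∑ i, ∑ j, f i j = ∑ i : Fin n, ∑ j : Fin n, f (φ i) (φ j) := by
    rw [← φ.sum_comp]
    exact sum_congr rfl fun i _ => (φ.sum_comp _).symm
  have h4 := sum_le_sum fun (i : Fin n) (_ : i ∈ univ) =>
    sum_le_sum fun (j : Fin n) (_ : j ∈ univ) => h2 i j
  simp only [sum_sub_distrib] at h4
  rw [h1, ← h3] at h4
  simp only [sum_const, card_univ, Fintype.card_fin, nsmul_eq_mul, sum_ite_eq, mem_univ, if_true,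
    mul_one] at h4
  rw [Nat.cast_choose_two]
  linarith

lemma connected_induce_singleton (G : SimpleGraph V) (v : V) : (G.induce {v}).Connected := by
  rw [induce_singleton_eq_top]
  exact connected_top

lemma connected_induce_of_two_adj (G : SimpleGraph V) {x y z : V} (hxz : G.Adj x z)
    (hyz : G.Adj y z) : (G.induce {x, y, z}).Connected := by
  have : ({x, y, z} : Set V) = {x, z} ∪ {y, z} := by
    ext; simp; tauto
  rw [this]
  exact induce_union_connected (induce_pair_connected_of_adj hxz).preconnected
    (induce_pair_connected_of_adj hyz).preconnected ⟨z, by simp, by simp⟩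

variable [Fintype V] {G : SimpleGraph V}

lemma not_adj_compl_of_indepNum_le_two (hα : G.indepNum ≤ 2) (x y z : V) (hxy : Gᶜ.Adj x y)
    (hxz : Gᶜ.Adj x z) : ¬Gᶜ.Adj y z := by
  classical
  intro hyz
  have h3 : Gᶜ.IsNClique 3 {x, y, z} := is3Clique_triple_iff.2 ⟨hxy, hxz, hyz⟩
  have h4 := h3.isClique.card_le_cliqueNum
  rw [cliqueNum_compl, h3.card_eq] at h4
  omega

lemma card_le_cliqueNum_of_not_adj_compl (I : Finset V) (hI : ∀ x ∈ I, ∀ y ∈ I, ¬Gᶜ.Adj x y) :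
    #I ≤ G.cliqueNum := by
  refine IsClique.card_le_cliqueNum (t := I) (tc := fun x hx y hy hxy => ?_)
  by_contra h
  exact hI x hx y hy ((compl_adj G x y).2 ⟨hxy, h⟩)

end SimpleGraph

namespace SimpleGraph

variable {V : Type*} [Fintype V] [DecidableEq V] {G : SimpleGraph V} [DecidableRel G.Adj]

/-- Contracting a partition into the vertices of a clique `Z`, as many seagulls, and a matching
gives a minor whose non-edges all involve the matching. -/
lemma exists_isMinorOf_of_matching (hα : G.indepNum ≤ 2) {n k m : ℕ}
    (hn : Fintype.card V = 2 * n) (hk : G.cliqueNum = k) (hk4 : 4 ≤ k) (hm : n = 2 * k + m)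
    {Z : Finset V} (hZ : G.IsNClique k Z) {ι : Type*} [DecidableEq ι] (g : ι × Fin 2 → V)
    (hg : Function.Injective g) (hgZ : ∀ i, g i ∉ Z) {s : Finset ι} (hs : #s = m)
    (hadj : ∀ i ∈ s, G.Adj (g (i, 0)) (g (i, 1))) :
    ∃ H : SimpleGraph (Fin n), H.IsMinorOf G ∧
      (n.choose 2 : ℝ) - (H.edgeSet.ncard : ℝ) ≤
        ∑ i ∈ s, (∑ z ∈ Z, if Gᶜ.Adj z (g (i, 0)) ∧ Gᶜ.Adj z (g (i, 1)) then (1 : ℝ) else 0) +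
        ∑ i ∈ s, ∑ j ∈ s, (if i = j then 0 else
          if Gᶜ.Adj (g (i, 0)) (g (j, 0)) ∧ Gᶜ.Adj (g (i, 0)) (g (j, 1)) ∧
            Gᶜ.Adj (g (i, 1)) (g (j, 0)) ∧ Gᶜ.Adj (g (i, 1)) (g (j, 1)) then (1 / 2 : ℝ) else 0) := by
  have htri := not_adj_compl_of_indepNum_le_two hα
  set P := (s ×ˢ (univ : Finset (Fin 2))).image g with hP
  have hPcard : #P = 2 * m := by
    rw [hP, card_image_of_injective _ hg, card_product, hs]
    simp [mul_comm]
  have hgP : ∀ i ∈ s, ∀ j, g (i, j) ∈ P := fun i hi j =>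
    mem_image.2 ⟨(i, j), by simp [hi], rfl⟩
  have hZP : Disjoint Z P := by
    rw [Finset.disjoint_left]
    intro x hx hx'
    obtain ⟨i, -, rfl⟩ := mem_image.1 hx'
    exact hgZ i hx
  set R := (Z ∪ P)ᶜ with hR
  have hRcard : #R = 3 * k := by
    have h1 : #(Z ∪ P) + #R = _ := card_add_card_compl (Z ∪ P)
    rw [card_union_of_disjoint hZP, hPcard, hZ.card_eq, hn] at h1
    omega
  obtain ⟨𝒯, h𝒯, h𝒯card⟩ := exists_isPacking_card_eq htri
    (fun I hI => hk ▸ card_le_cliqueNum_of_not_adj_compl I hI) hRcard hk4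
  have hTZ : ∀ T ∈ 𝒯, ∀ x ∈ T, x ∉ Z ∧ x ∉ P := by
    intro T hT x hx
    have := h𝒯.subset T hT hx
    rw [hR, mem_compl, mem_union] at this
    tauto
  let B : {z // z ∈ Z} ⊕ {T // T ∈ 𝒯} ⊕ {i // i ∈ s} → Set V :=
    Sum.elim (fun z => {z.1}) (Sum.elim (fun T => (T.1 : Set V))
      (fun i => {g (i.1, 0), g (i.1, 1)}))
  have hcompl : ∀ {x y}, x ≠ y → ¬G.Adj x y → Gᶜ.Adj x y := fun h h' => (compl_adj G _ _).2 ⟨h, h'⟩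
  have hadj' : ∀ {x y}, x ≠ y → ¬Gᶜ.Adj x y → G.Adj x y := fun h h' => by
    by_contra h''
    exact h' (hcompl h h'')
  have hBP : ∀ i : {i // i ∈ s}, ∀ x ∈ B (Sum.inr (Sum.inr i)), x ∈ P := by
    rintro i x (rfl | rfl)
    exacts [hgP _ i.2 _, hgP _ i.2 _]
  have hconn : ∀ i, (G.induce (B i)).Connected := by
    rintro (z | T | i)
    · exact connected_induce_singleton G z.1
    · obtain ⟨x, y, z, hT, hxy, hxz, hyz⟩ := h𝒯.oneEdge T.1 T.2
      have h1 : x ≠ z := by rintro rfl; exact hyz hxy.symm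
      have h2 : y ≠ z := by rintro rfl; exact hxz hxy
      have h3 : B (Sum.inr (Sum.inl T)) = {x, y, z} := by
        change ((T.1 : Finset V) : Set V) = _
        rw [hT]
        simp
      rw [h3]
      exact connected_induce_of_two_adj G (hadj' h1 hxz) (hadj' h2 hyz)
    · exact induce_pair_connected_of_adj (hadj i.1 i.2)
  -- If both ends of the `K`-edge of `T` missed `v`, they would form a triangle of `K` with it.
  have hdom : ∀ T ∈ 𝒯, ∀ v, v ∉ T → ∃ x ∈ T, G.Adj x v := by
    intro T hT v hv
    obtain ⟨x, y, z, rfl, hxy, hxz, hyz⟩ := h𝒯.oneEdge T hT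
    simp only [mem_insert, mem_singleton, not_or] at hv
    by_contra hcon
    push Not at hcon
    exact htri x y v hxy (hcompl (Ne.symm hv.1) (hcon x (by simp)))
      (hcompl (Ne.symm hv.2.1) (hcon y (by simp)))
  have hdisj : ∀ i j, i ≠ j → Disjoint (B i) (B j) := by
    have hZT : ∀ (z : {z // z ∈ Z}) (T : {T // T ∈ 𝒯}),
        Disjoint (B (Sum.inl z)) (B (Sum.inr (Sum.inl T))) := by
      intro z T
      rw [Set.disjoint_left]
      rintro x rfl hx
      exact (hTZ T.1 T.2 _ hx).1 z.2
    have hZi : ∀ (z : {z // z ∈ Z}) (i : {i // i ∈ s}),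
        Disjoint (B (Sum.inl z)) (B (Sum.inr (Sum.inr i))) := by
      intro z i
      rw [Set.disjoint_left]
      rintro x rfl hx
      exact Finset.disjoint_left.1 hZP z.2 (hBP i _ hx)
    have hTi : ∀ (T : {T // T ∈ 𝒯}) (i : {i // i ∈ s}),
        Disjoint (B (Sum.inr (Sum.inl T))) (B (Sum.inr (Sum.inr i))) := by
      intro T i
      rw [Set.disjoint_left]
      exact fun x hx hx' => (hTZ T.1 T.2 _ hx).2 (hBP i _ hx')
    rintro (z | T | i) (z' | T' | j) hij
    · refine Set.disjoint_singleton.2 fun h => hij ?_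
      rw [Subtype.ext h]
    · exact hZT _ _
    · exact hZi _ _
    · exact (hZT _ _).symm
    · refine Finset.disjoint_coe.2 (h𝒯.disj _ T.2 _ T'.2 fun h => hij ?_)
      rw [Subtype.ext h]
    · exact hTi _ _
    · exact (hZi _ _).symm
    · exact (hTi _ _).symm
    · have hne : i.1 ≠ j.1 := fun h => hij (by rw [Subtype.ext h])
      rw [Set.disjoint_left]
      rintro x (rfl | rfl) (h | h) <;>
        exact hne (congrArg Prod.fst (hg h))
  let c : V → ι → ℝ := fun z i => if Gᶜ.Adj z (g (i, 0)) ∧ Gᶜ.Adj z (g (i, 1)) then 1 else 0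
  let d : ι → ι → ℝ := fun i j => if i = j then 0 else
          if Gᶜ.Adj (g (i, 0)) (g (j, 0)) ∧ Gᶜ.Adj (g (i, 0)) (g (j, 1)) ∧
            Gᶜ.Adj (g (i, 1)) (g (j, 0)) ∧ Gᶜ.Adj (g (i, 1)) (g (j, 1)) then (1 / 2 : ℝ) else 0
  have hc : ∀ z i, 0 ≤ c z i := by
    intro z i
    simp only [c]
    split_ifs <;> norm_num
  have hd : ∀ i j, 0 ≤ d i j := by
    intro z i
    simp only [d]
    split_ifs <;> norm_num
  have hcl : ∀ (z : {z // z ∈ Z}) (i : {i // i ∈ s}),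
      (∀ x ∈ B (Sum.inl z), ∀ y ∈ B (Sum.inr (Sum.inr i)), ¬G.Adj x y) → 1 ≤ c z.1 i.1 := by
    intro z i h
    have h0 : ∀ j, z.1 ≠ g (i.1, j) := fun j h' => hgZ _ (h' ▸ z.2)
    have h1 := hcompl (h0 0) (h z.1 rfl _ (Or.inl rfl))
    have h2 := hcompl (h0 1) (h z.1 rfl _ (Or.inr rfl))
    simp only [c]
    rw [if_pos ⟨h1, h2⟩]
  -- The factor 2 undoes the 1/2 in `d`: `f` must be at least 1 on each ordered non-adjacent pair,
  -- and `exists_isMinorOf` halves the ordered sum.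
  let f : {z // z ∈ Z} ⊕ {T // T ∈ 𝒯} ⊕ {i // i ∈ s} → {z // z ∈ Z} ⊕ {T // T ∈ 𝒯} ⊕ {i // i ∈ s} →
      ℝ := Sum.elim (fun z => Sum.elim (fun _ => 0) (Sum.elim (fun _ => 0) fun i => c z.1 i.1))
    (Sum.elim (fun _ _ => 0) fun i => Sum.elim (fun z => c z.1 i.1)
      (Sum.elim (fun _ => 0) fun j => 2 * d i.1 j.1))
  obtain ⟨H, hH, hHle⟩ := exists_isMinorOf G (n := n)
    (by simp [hZ.card_eq, h𝒯card, hs]; omega) B hconn hdisj f (by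
      rintro (z | T | i) (z' | T' | j) <;> simp [f, hc, hd]) (by
      have hT : ∀ (T : {T // T ∈ 𝒯}) (i), Sum.inr (Sum.inl T) ≠ i →
          ∃ x ∈ B (Sum.inr (Sum.inl T)), ∃ y ∈ B i, G.Adj x y := by
        intro T i hTi
        obtain ⟨v, hv⟩ := (hconn i).nonempty
        obtain ⟨x, hx, hxv⟩ := hdom T.1 T.2 v fun hvT =>
          Set.disjoint_left.1 (hdisj _ _ hTi) hvT hv
        exact ⟨x, hx, v, hv, hxv⟩
      rintro (z | T | i) (z' | T' | j) hij hno
      · refine absurd (hZ.isClique z.2 z'.2 fun h => hij ?_) (hno z.1 rfl z'.1 rfl)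
        rw [Subtype.ext h]
      · obtain ⟨x, hx, y, hy, hxy⟩ := hT T' _ hij.symm
        exact absurd hxy.symm (hno y hy x hx)
      · exact hcl z j hno
      · obtain ⟨x, hx, y, hy, hxy⟩ := hT T _ hij
        exact absurd hxy (hno x hx y hy)
      · obtain ⟨x, hx, y, hy, hxy⟩ := hT T _ hij
        exact absurd hxy (hno x hx y hy)
      · obtain ⟨x, hx, y, hy, hxy⟩ := hT T _ hij
        exact absurd hxy (hno x hx y hy)
      · exact hcl z' i fun x hx y hy hxy => hno y hy x hx hxy.symm
      · obtain ⟨x, hx, y, hy, hxy⟩ := hT T' _ hij.symm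
        exact absurd hxy.symm (hno y hy x hx)
      · have hne : i.1 ≠ j.1 := fun h => hij (by rw [Subtype.ext h])
        have h0 : ∀ a b, g (i.1, a) ≠ g (j.1, b) := fun a b h => hne (congrArg Prod.fst (hg h))
        have h00 := hcompl (h0 0 0) (hno _ (Or.inl rfl) _ (Or.inl rfl))
        have h01 := hcompl (h0 0 1) (hno _ (Or.inl rfl) _ (Or.inr rfl))
        have h10 := hcompl (h0 1 0) (hno _ (Or.inr rfl) _ (Or.inl rfl))
        have h11 := hcompl (h0 1 1) (hno _ (Or.inr rfl) _ (Or.inr rfl))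
        simp only [f, d, Sum.elim_inr]
        rw [if_neg hne, if_pos ⟨h00, h01, h10, h11⟩]
        norm_num)
  refine ⟨H, hH, hHle.trans (le_of_eq ?_)⟩
  have e1 : ∑ z : {z // z ∈ Z}, ∑ i : {i // i ∈ s}, c z.1 i.1 = ∑ i ∈ s, ∑ z ∈ Z, c z i := by
    rw [sum_comm, ← sum_coe_sort s fun i => ∑ z ∈ Z, c z i]
    exact sum_congr rfl fun i _ => sum_coe_sort Z fun z => c z i.1
  have e2 : ∑ i : {i // i ∈ s}, ∑ j : {i // i ∈ s}, 2 * d i.1 j.1 =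
      2 * ∑ i ∈ s, ∑ j ∈ s, d i j := by
    rw [← sum_coe_sort s fun i => ∑ j ∈ s, d i j, mul_sum]
    refine sum_congr rfl fun i _ => ?_
    rw [← sum_coe_sort s fun j => d i.1 j, mul_sum]
  have e3 : ∑ i : {i // i ∈ s}, ∑ z : {z // z ∈ Z}, c z.1 i.1 = ∑ i ∈ s, ∑ z ∈ Z, c z i := by
    rw [← e1, sum_comm]
  simp only [Fintype.sum_sum_type, f, Sum.elim_inl, Sum.elim_inr, sum_const_zero, zero_add,
    add_zero, sum_add_distrib]
  rw [e1, e2, e3]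
  simp only [c, d]
  ring

end SimpleGraph

/-! ### Numerical estimates -/

section Estimates

lemma linear_estimate {N h q : ℝ} (hN : 4 < N) (hh : 2 * h ≤ N) (hq : 0 ≤ q) :
    h * q / (N * (N - 1)) ≤ q / (2 * (N - 2)) := by
  have h1 : 0 < N - 1 := by linarith
  have h2 : 0 < N - 2 := by linarith
  have h0 : 0 < N := by linarith
  rw [div_le_div_iff₀ (by positivity) (by positivity)]
  have : h * (2 * (N - 2)) ≤ N * (N - 1) := by nlinarith
  nlinarith [mul_le_mul_of_nonneg_right this hq]

lemma quadratic_estimate {N h q : ℝ} (hN : 4 < N) (hh : 2 * h ≤ N) (hh1 : 1 ≤ h) (hq : 0 ≤ q) :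
    h * (h - 1) * q / (N * (N - 1) * (N - 2) * (N - 3)) ≤ q / (4 * (N - 2) * (N - 4)) := by
  have h1 : 0 < N - 1 := by linarith
  have h2 : 0 < N - 2 := by linarith
  have h3 : 0 < N - 3 := by linarith
  have h4 : 0 < N - 4 := by linarith
  have h0 : 0 < N := by linarith
  have e1 : h * (h - 1) ≤ N * (N - 2) / 4 := by nlinarith
  calc h * (h - 1) * q / (N * (N - 1) * (N - 2) * (N - 3))
      ≤ N * (N - 2) / 4 * q / (N * (N - 1) * (N - 2) * (N - 3)) := by gcongr
    _ = q / (4 * (N - 1) * (N - 3)) := by field_simp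
    _ ≤ q / (4 * (N - 2) * (N - 4)) := by
        gcongr <;> linarith

/-- Applied with `N = 2n - k` and `N' = 2n`, to pass from the moment bounds to the stated form. -/
lemma conditional_estimate {N N' h C Q A B t : ℝ} (hN : 4 < N) (hNN : N ≤ N') (ht : N' < t ^ 2)
    (hh : 2 * h ≤ N) (hh1 : 1 ≤ h) (hC0 : 0 ≤ C) (hQ0 : 0 ≤ Q) (hC : C ≤ A) (hQ : Q ≤ B) :
    1 / (1 - N / t ^ 2) * (h * C / (N * (N - 1)) +
      h * (h - 1) * Q / (N * (N - 1) * (N - 2) * (N - 3))) ≤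
    1 / (1 - N' / t ^ 2) * (B / (4 * (N - 2) * (N - 4)) + A / (2 * (N - 2))) := by
  have ht0 : 0 < t ^ 2 := by linarith
  have h1 : 0 < 1 - N' / t ^ 2 := by
    rw [sub_pos, div_lt_one ht0]
    exact ht
  have p1 : 0 < N - 1 := by linarith
  have p2 : 0 < N - 2 := by linarith
  have p3 : 0 < N - 3 := by linarith
  have p4 : 0 < N - 4 := by linarith
  have p0 : 0 < N := by linarith
  have ph : 0 ≤ h - 1 := by linarith
  have ph' : 0 ≤ h := by linarith
  refine mul_le_mul ?_ ?_ (by positivity) (by positivity)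
  · gcongr
  · rw [add_comm]
    refine add_le_add ((quadratic_estimate hN hh hh1 hQ0).trans ?_)
      ((linear_estimate hN hh hC0).trans ?_)
    · gcongr
    · gcongr

end Estimates

/-! ### Counting cherries and four-cycles in the complement -/

namespace SimpleGraph

variable {V : Type*} [Fintype V] [DecidableEq V] {K : SimpleGraph V} [DecidableRel K.Adj] {k : ℕ}

lemma card_filter_adj_subtype_le (hK : ∀ x, #(univ.filter (K.Adj x)) ≤ k) (Z : Finset V) (x : V) :
    #(univ.filter fun y : {v // v ∉ Z} => K.Adj x y) ≤ k := by
  refine le_trans ?_ (hK x)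
  exact card_le_card_of_injOn Subtype.val (by intro y hy; simpa using hy)
    Subtype.val_injective.injOn

lemma sum_adj_ne_le (hK : ∀ x, #(univ.filter (K.Adj x)) ≤ k) {Z : Finset V} {z : V}
    {x : {v // v ∉ Z}} (hzx : K.Adj z x) :
    ∑ y : {v // v ∉ Z}, (if x ≠ y ∧ K.Adj z y then (1 : ℝ) else 0) ≤ k - 1 := by
  rw [sum_boole]
  have h1 : (univ.filter fun y : {v // v ∉ Z} => x ≠ y ∧ K.Adj z y) =
      (univ.filter fun y : {v // v ∉ Z} => K.Adj z y).erase x := by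
    ext y
    simp [eq_comm]
  have h2 := card_erase_add_one (s := univ.filter fun y : {v // v ∉ Z} => K.Adj z y) (a := x)
    (by simpa using hzx)
  have h3 := card_filter_adj_subtype_le hK Z z
  rw [h1, le_sub_iff_add_le]
  exact_mod_cast h2.trans_le h3

/-- Once `z` and its neighbour `x` are fixed, at most `k - 1` choices of `y` remain. -/
lemma sum_common_neighbor_le (hk : 1 ≤ k) (hK : ∀ x, #(univ.filter (K.Adj x)) ≤ k)
    (Z : Finset V) :
    ∑ x : {v // v ∉ Z}, ∑ y : {v // v ∉ Z}, (if x = y then 0 else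
      ∑ z ∈ Z, if K.Adj z x ∧ K.Adj z y then (1 : ℝ) else 0) ≤
      (k - 1) * ((∑ z ∈ Z, K.degree z : ℕ) : ℝ) := by
  have hk' : (0 : ℝ) ≤ k - 1 := by
    rw [sub_nonneg]
    exact_mod_cast hk
  have h1 : ∀ x y : {v // v ∉ Z}, (if x = y then 0 else
      ∑ z ∈ Z, if K.Adj z x ∧ K.Adj z y then (1 : ℝ) else 0) =
      ∑ z ∈ Z, if K.Adj z x then (if x ≠ y ∧ K.Adj z y then (1 : ℝ) else 0) else 0 := by
    intro x y
    split_ifs with hxy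
    · simp [hxy]
    · refine sum_congr rfl fun z _ => ?_
      by_cases h1 : K.Adj z x <;> simp [hxy, h1]
  calc _ = ∑ z ∈ Z, ∑ x : {v // v ∉ Z}, ∑ y : {v // v ∉ Z},
        if K.Adj z x then (if x ≠ y ∧ K.Adj z y then (1 : ℝ) else 0) else 0 :=
        (sum_congr rfl fun x _ => (sum_congr rfl fun y _ => h1 x y).trans sum_comm).trans sum_comm
    _ ≤ ∑ z ∈ Z, ∑ x : {v // v ∉ Z}, (k - 1) * if K.Adj z x then (1 : ℝ) else 0 := by
        refine sum_le_sum fun z _ => sum_le_sum fun x _ => ?_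
        split_ifs with h
        · rw [mul_one]
          exact sum_adj_ne_le hK h
        · simp
    _ = (k - 1) * ∑ z ∈ Z, (#(univ.filter fun x : {v // v ∉ Z} => K.Adj z x) : ℝ) := by
        rw [mul_sum]
        refine sum_congr rfl fun z _ => ?_
        rw [← mul_sum, sum_boole]
    _ ≤ _ := by
        push_cast
        gcongr with z
        rw [← card_neighborFinset_eq_degree, neighborFinset_eq_filter]
        exact card_le_card_of_injOn Subtype.val (by intro y hy; simpa using hy)
          Subtype.val_injective.injOn

/-- Fix the edge `xz` of the four-cycle: `y` is another neighbour of `z` and `w` another neighbour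
of `x`, at most `(k - 1)²` choices. -/
lemma sum_four_cycle_le (hk : 1 ≤ k) (hK : ∀ x, #(univ.filter (K.Adj x)) ≤ k)
    (Z : Finset V) :
    ∑ x : {v // v ∉ Z}, ∑ y : {v // v ∉ Z}, ∑ z : {v // v ∉ Z}, ∑ w : {v // v ∉ Z},
      (if x ≠ y ∧ z ≠ w then (if K.Adj x z ∧ K.Adj x w ∧ K.Adj y z ∧ K.Adj y w then (1 / 2 : ℝ)
        else 0) else 0) ≤
      (k - 1) ^ 2 * ((∑ x : {v // v ∉ Z}, ∑ y : {v // v ∉ Z}, if K.Adj x y then (1 : ℝ) else 0) /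
        2) := by
  have hk' : (0 : ℝ) ≤ k - 1 := by
    rw [sub_nonneg]
    exact_mod_cast hk
  have key : ∀ x z : {v // v ∉ Z}, ∑ y : {v // v ∉ Z}, ∑ w : {v // v ∉ Z},
      (if x ≠ y ∧ z ≠ w then (if K.Adj x z ∧ K.Adj x w ∧ K.Adj y z ∧ K.Adj y w then (1 / 2 : ℝ)
        else 0) else 0) ≤ (k - 1) ^ 2 / 2 * if K.Adj x z then (1 : ℝ) else 0 := by
    intro x z
    by_cases hxz : K.Adj x z
    · rw [if_pos hxz, mul_one]
      calc _ ≤ ∑ y : {v // v ∉ Z}, ∑ w : {v // v ∉ Z},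
            (if x ≠ y ∧ K.Adj z y then (1 : ℝ) else 0) *
              (if z ≠ w ∧ K.Adj x w then (1 : ℝ) else 0) / 2 := by
            refine sum_le_sum fun y _ => sum_le_sum fun w _ => ?_
            by_cases h1 : x ≠ y ∧ z ≠ w
            · by_cases h2 : K.Adj x z ∧ K.Adj x w ∧ K.Adj y z ∧ K.Adj y w
              · rw [if_pos h1, if_pos h2, if_pos ⟨h1.1, h2.2.2.1.symm⟩, if_pos ⟨h1.2, h2.2.1⟩]
                norm_num
              · rw [if_pos h1, if_neg h2]
                positivity
            · rw [if_neg h1]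
              positivity
        _ = (∑ y : {v // v ∉ Z}, if x ≠ y ∧ K.Adj z y then (1 : ℝ) else 0) *
              (∑ w : {v // v ∉ Z}, if z ≠ w ∧ K.Adj x w then (1 : ℝ) else 0) / 2 := by
            rw [sum_mul_sum, sum_div]
            exact sum_congr rfl fun y _ => (sum_div _ _ _).symm
        _ ≤ (k - 1) * (k - 1) / 2 := by
            have h1 := sum_adj_ne_le hK hxz.symm
            have h2 := sum_adj_ne_le hK hxz
            have h3 : (0 : ℝ) ≤ ∑ w : {v // v ∉ Z}, if z ≠ w ∧ K.Adj x w then (1 : ℝ) else 0 :=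
              sum_nonneg fun w _ => by positivity
            gcongr
        _ = _ := by ring
    · simp [hxz]
  calc _ = ∑ x : {v // v ∉ Z}, ∑ z : {v // v ∉ Z}, ∑ y : {v // v ∉ Z}, ∑ w : {v // v ∉ Z},
      (if x ≠ y ∧ z ≠ w then (if K.Adj x z ∧ K.Adj x w ∧ K.Adj y z ∧ K.Adj y w then (1 / 2 : ℝ)
        else 0) else 0) := sum_congr rfl fun x _ => sum_comm
    _ ≤ ∑ x : {v // v ∉ Z}, ∑ z : {v // v ∉ Z},
        (k - 1) ^ 2 / 2 * if K.Adj x z then (1 : ℝ) else 0 :=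
        sum_le_sum fun x _ => sum_le_sum fun z _ => key x z
    _ = _ := by
        simp only [← mul_sum]
        ring

end SimpleGraph

/-! ### Assembly of the main theorem -/

open SimpleGraph
theorem lemmal {V : Type*} [Fintype V] [DecidableEq V]
    (G : SimpleGraph V) [DecidableRel G.Adj] (n k : ℕ)
    (hn : Fintype.card V = 2 * n) (h6 : 6 ≤ Fintype.card V)
    (hα : G.indepNum ≤ 2)
    (hk : k = G.cliqueNum) (hω : (k : ℝ) < (Fintype.card V : ℝ) / 4)
    (Z : Finset V) (hZ : G.IsNClique k Z)
    (a b : ℕ)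
    (ha : a = ∑ v ∈ Z, Gᶜ.degree v)
    (hb : b = (Gᶜ.induce {v : V | v ∉ Z}).edgeSet.ncard)
    (lam : ℝ) (hlam0 : 0 < lam) (hlam1 : lam ≤ ((k : ℝ) - 1) / 2)
    (hlam2 : 2 * (n : ℝ) < lam ^ 2)
    (p : ℝ)
    (hp : p = ((n : ℝ) - 2 * k) /
      ((n : ℝ) - ((k : ℝ) + 1) / 2 - (b : ℝ) / (2 * (n : ℝ) - k - 2) - lam)) :
    ∃ H : SimpleGraph (Fin n), H.IsMinorOf G ∧
      (n.choose 2 : ℝ) - (H.edgeSet.ncard : ℝ) ≤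
        1 / (1 - 2 * (n : ℝ) / lam ^ 2) *
          ((b : ℝ) * ((k : ℝ) - 1) ^ 2 * p ^ 2 /
              (4 * (2 * (n : ℝ) - k - 2) * (2 * (n : ℝ) - k - 4)) +
            (a : ℝ) * ((k : ℝ) - 1) * p / (2 * (2 * (n : ℝ) - k - 2))) := by
  have htri := not_adj_compl_of_indepNum_le_two hα
  have hK : ∀ x, #(univ.filter (Gᶜ.Adj x)) ≤ k := fun x => by
    rw [hk]
    exact card_le_cliqueNum_of_not_adj_compl _ fun y hy z hz =>
      htri x y z (mem_filter.1 hy).2 (mem_filter.1 hz).2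
  have hn3 : (3 : ℝ) ≤ n := by
    have : 3 ≤ n := by omega
    exact_mod_cast this
  have hkn : 2 * k < n := by
    have : (4 * k : ℝ) < 2 * n := by
      rw [hn] at hω
      push_cast at hω
      linarith
    have : 4 * k < 2 * n := by exact_mod_cast this
    omega
  -- If `k ≤ 5` then `λ ≤ 2`, so `λ² ≤ 4 < 6 ≤ 2n`. The packing theorem needs `k ≥ 4`.
  have hk6 : 6 ≤ k := by
    by_contra hcon
    have : (k : ℝ) ≤ 5 := by exact_mod_cast (by omega : k ≤ 5)
    nlinarith
  have hk6' : (6 : ℝ) ≤ k := by exact_mod_cast hk6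
  have hkn' : 2 * (k : ℝ) + 1 ≤ n := by exact_mod_cast hkn
  have hcard : Fintype.card {v // v ∉ Z} + k = 2 * n := by
    rw [Fintype.card_of_subtype Zᶜ (fun x => mem_compl), ← hn, ← hZ.card_eq]
    exact card_compl_add_card Z
  set N := Fintype.card {v // v ∉ Z} with hN
  have hcard' : (N : ℝ) = 2 * n - k := by
    rw [eq_sub_iff_add_eq]
    exact_mod_cast hcard
  set h := N / 2 with hh
  have hh2 : 2 * (h : ℝ) ≤ N := by exact_mod_cast (by omega : 2 * h ≤ N)
  have hh1 : (N : ℝ) - 1 ≤ 2 * h := by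
    have : N ≤ 2 * h + 1 := by omega
    rw [sub_le_iff_le_add]
    exact_mod_cast this
  obtain ⟨e⟩ : Nonempty (Fin h × Fin 2 ↪ {v // v ∉ Z}) :=
    Function.Embedding.nonempty_of_card_le (by
      rw [Fintype.card_prod, Fintype.card_fin, Fintype.card_fin, ← hN]; omega)
  have hS : ∑ x : {v // v ∉ Z}, ∑ y : {v // v ∉ Z}, (if Gᶜ.Adj x y then (1 : ℝ) else 0) =
      2 * b := by
    rw [hb]
    exact sum_adj_eq_two_mul_ncard (V := {v // v ∉ Z}) (Gᶜ.induce {v : V | v ∉ Z})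
  have hbN : 2 * (b : ℝ) ≤ N * k := by
    rw [← hS, hN, ← card_univ, ← nsmul_eq_mul, ← sum_const]
    refine sum_le_sum fun x _ => ?_
    rw [sum_boole]
    exact_mod_cast card_filter_adj_subtype_le hK Z x
  have hb0 : (0 : ℝ) ≤ b := by positivity
  have ha0 : (0 : ℝ) ≤ a := by positivity
  have hN2 : 0 < (N : ℝ) - 2 := by rw [hcard']; linarith
  set D : ℝ := n - ((k : ℝ) + 1) / 2 - b / (2 * (n : ℝ) - k - 2) - lam with hD
  have hbk : b / ((N : ℝ) - 2) ≤ k := by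
    rw [div_le_iff₀ hN2]
    nlinarith
  have hDN : D = ((N : ℝ) - 1) / 2 - b / ((N : ℝ) - 2) - lam := by
    rw [hD, hcard']
    ring
  -- The extreme values `b/(N - 2) = k` and `λ = (k - 1)/2` give exactly `n - 2k`: the upper bound
  -- on λ guarantees enough pairs to select from.
  have hDm : (n : ℝ) - 2 * k ≤ D := by
    rw [hDN]
    linarith
  have hD0 : 0 < D := by linarith
  have hp0 : 0 ≤ p := by
    rw [hp]
    exact div_nonneg (by linarith) hD0.le
  let c₀ : V → V → ℝ := fun x y => ∑ z ∈ Z, if Gᶜ.Adj z x ∧ Gᶜ.Adj z y then (1 : ℝ) else 0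
  let d₀ : V → V → V → V → ℝ := fun x y z w =>
    if Gᶜ.Adj x z ∧ Gᶜ.Adj x w ∧ Gᶜ.Adj y z ∧ Gᶜ.Adj y w then (1 / 2 : ℝ) else 0
  have hc₀ : ∀ x y, 0 ≤ c₀ x y := fun x y => sum_nonneg fun z _ => by positivity
  have hd₀ : ∀ x y z w, 0 ≤ d₀ x y z w := fun x y z w => by simp only [d₀]; positivity
  -- The weights already carry `p` and `p²`, so one `σ` bounds the combined cost left after the
  -- later selection.
  obtain ⟨σ, hσX, hσT⟩ := exists_perm_weight_le e (t := lam) (by omega)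
    (fun x y => if Gᶜ.Adj x y then (1 : ℝ) else 0) (fun x y => by split_ifs <;> simp)
    (by simp) (by rw [hS, ← hN]; nlinarith)
    (fun x y => p * if x = y then 0 else c₀ x y)
    (fun x y => mul_nonneg hp0 (by split_ifs; exacts [le_rfl, hc₀ _ _])) (by simp)
    (fun x y z w => p ^ 2 * d₀ x y z w)
    (fun x y z w => mul_nonneg (sq_nonneg p) (hd₀ _ _ _ _)) hlam0
    (by rw [← hN, hcard']; linarith)
  rw [← hN, hS] at hσX
  rw [← hN] at hσT
  let g : Fin h × Fin 2 → V := fun i => (σ (e i)).1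
  have hg : Function.Injective g := Subtype.val_injective.comp (σ.injective.comp e.injective)
  set S := univ.filter fun i : Fin h => ¬Gᶜ.Adj (g (i, 0)) (g (i, 1)) with hSdef
  -- `h ≥ (N - 1)/2` covers odd `N`, and at most `b/(N - 2) + λ` pairs lie in the complement.
  have hScard : D ≤ #S := by
    have h1 : ((#(univ.filter fun i : Fin h => Gᶜ.Adj (g (i, 0)) (g (i, 1))) : ℕ) : ℝ) + #S = h := by
      have := card_filter_add_card_filter_not (s := (univ : Finset (Fin h)))
        (fun i => Gᶜ.Adj (g (i, 0)) (g (i, 1)))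
      rw [card_univ, Fintype.card_fin] at this
      exact_mod_cast this
    rw [sum_boole] at hσX
    have h2 : h * (2 * b) / ((N : ℝ) * (N - 1)) ≤ 2 * b / (2 * (N - 2)) :=
      linear_estimate (by linarith) hh2 (by positivity)
    rw [mul_div_mul_left _ _ two_ne_zero] at h2
    rw [hDN]
    have h3 : ((#(univ.filter fun i : Fin h => Gᶜ.Adj (g (i, 0)) (g (i, 1))) : ℕ) : ℝ) ≤
      h * (2 * b) / ((N : ℝ) * (N - 1)) + lam := hσX
    linarith
  set m := n - 2 * k with hm
  have hmcast : (m : ℝ) = n - 2 * k := by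
    rw [hm, Nat.cast_sub hkn.le]
    push_cast
    ring
  have hmS : m ≤ #S := by
    have : (m : ℝ) ≤ #S := by rw [hmcast]; exact hDm.trans hScard
    exact_mod_cast this
  have hq : (m / #S : ℝ) ≤ p := by
    rw [hp, ← hmcast]
    gcongr
  let d₁ : Fin h → Fin h → ℝ := fun i j =>
    if i = j then 0 else d₀ (g (i, 0)) (g (i, 1)) (g (j, 0)) (g (j, 1))
  have hd₁ : ∀ i j, 0 ≤ d₁ i j := fun i j => by
    simp only [d₁]
    split_ifs
    exacts [le_rfl, hd₀ _ _ _ _]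
  obtain ⟨s, hsS, hsm, hsle⟩ := exists_subset_weight_le_of_div_le S (by omega : 0 < m) hmS
    hq (fun i => c₀ (g (i, 0)) (g (i, 1))) d₁ (fun i => hc₀ _ _) hd₁ (fun i => by simp [d₁])
  obtain ⟨H, hH, hHle⟩ := exists_isMinorOf_of_matching hα hn hk.symm (by omega)
    (by omega : n = 2 * k + m) hZ g hg (fun i => (σ (e i)).2) hsm (fun i hi => by
      have h1 := (mem_filter.1 (hsS hi)).2
      by_contra h2
      exact h1 ((compl_adj G _ _).2 ⟨fun h3 => absurd (hg h3) (by simp), h2⟩))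
  refine ⟨H, hH, hHle.trans (hsle.trans ?_)⟩
  refine (le_of_eq (b := (∑ i, p * if σ (e (i, 0)) = σ (e (i, 1)) then 0 else
    c₀ (g (i, 0)) (g (i, 1))) + ∑ i, ∑ j, if i = j then 0 else
      p ^ 2 * d₀ (g (i, 0)) (g (i, 1)) (g (j, 0)) (g (j, 1))) ?_).trans (hσT.trans ?_)
  · congr 1
    · refine sum_congr rfl fun i _ => ?_
      rw [if_neg fun h' => absurd (e.injective (σ.injective h')) (by simp)]
    · refine sum_congr rfl fun i _ => sum_congr rfl fun j _ => ?_
      simp only [d₁]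
      split_ifs
      exacts [mul_zero _, rfl]
  have hk1 : (0 : ℝ) ≤ k - 1 := by linarith
  have hC : ∑ x : {v // v ∉ Z}, ∑ y : {v // v ∉ Z}, p * (if x = y then 0 else c₀ x y) ≤
      a * (k - 1) * p := by
    have e1 : ∑ x : {v // v ∉ Z}, ∑ y : {v // v ∉ Z}, p * (if x = y then 0 else c₀ x y) =
        p * ∑ x : {v // v ∉ Z}, ∑ y : {v // v ∉ Z}, (if x = y then 0 else c₀ x y) := by
      rw [mul_sum]
      exact sum_congr rfl fun i _ => (mul_sum _ _ _).symm
    rw [e1]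
    have h1 := sum_common_neighbor_le (by omega) hK Z
    rw [← ha] at h1
    calc _ ≤ p * ((k - 1) * (a : ℝ)) := mul_le_mul_of_nonneg_left h1 hp0
      _ = _ := by ring
  have hQ : ∑ x : {v // v ∉ Z}, ∑ y : {v // v ∉ Z}, ∑ z : {v // v ∉ Z}, ∑ w : {v // v ∉ Z},
      (if x ≠ y ∧ z ≠ w then p ^ 2 * d₀ x y z w else 0) ≤ b * (k - 1) ^ 2 * p ^ 2 := by
    have h1 := sum_four_cycle_le (by omega) hK Z
    rw [hS, mul_div_cancel_left₀ _ two_ne_zero] at h1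
    have h2 : ∀ x y z w : {v // v ∉ Z}, (if x ≠ y ∧ z ≠ w then p ^ 2 * d₀ x y z w else 0) =
        p ^ 2 * if x ≠ y ∧ z ≠ w then d₀ x y z w else 0 := fun x y z w => by
      split_ifs <;> simp
    simp only [h2, ← mul_sum]
    calc _ ≤ p ^ 2 * ((k - 1) ^ 2 * (b : ℝ)) := mul_le_mul_of_nonneg_left h1 (sq_nonneg p)
      _ = _ := by ring
  have hh1' : (1 : ℝ) ≤ h := by linarith
  rw [← hcard']
  refine conditional_estimate (by linarith) (by linarith) hlam2 hh2 hh1' ?_ ?_ hC hQ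
  · refine sum_nonneg fun x _ => sum_nonneg fun y _ => mul_nonneg hp0 ?_
    split_ifs
    exacts [le_rfl, hc₀ _ _]
  · refine sum_nonneg fun x _ => sum_nonneg fun y _ => sum_nonneg fun z _ =>
      sum_nonneg fun w _ => ?_
    split_ifs
    exacts [mul_nonneg (sq_nonneg p) (hd₀ _ _ _ _), le_rfl]
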